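/- **Notation.** Let $F$ be a probability distribution on a set $\mathcal X\subset\mathbb R^d$ such that $\langle x,x'\rangle\in[0,1]$ for all $x,x'\in\mathcal X$. A pair $(X,A)\sim\mathrm{RDPG}(F)$ on $n$ vertices is a *random dot product graph* if $X=[X_1,\dots,X_n]^\top\in\mathbb R^{n\times d}$ with $X_1,\dots,X_n$ i.i.d. $\sim F$, and $A\in\{0,1\}^{n\times n}$ is a random symmetric matrix with zero diagonal such that $$\mathbb P[A\mid X]=\prod_{i>j}(X_i^\top X_j)^{A_{ij}}(1-X_i^\top X_j)^{1-A_{ij}}.$$ An *adjacency spectral embedding* of $A$ into $\mathbb R^d$ ($d\le n$) is a matrix $\hat X=U_AS_A^{1/2}\in\mathbb R^{n\times d}$, where $|A|=(A^\top A)^{1/2}=[U_A|\tilde U_A][S_A\oplus\tilde S_A][U_A|\tilde U_A]^\top$ is a spectral decomposition with orthogonal $[U_A|\tilde U_A]$, and $S_A$ is the diagonal matrix of the $d$ largest eigenvalues of $|A|$ in decreasing order. For $M\in\mathbb R^{n\times d}$, $\|M\|_{2\to\infty}$ is the largest Euclidean norm of a row of $M$. A sequence of events $E_n$ *occurs asymptotically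 almost surely* if for every $c>0$ there is $n_0(c)$ such that $\mathbb P(E_n)\ge 1-\eta$ whenever $n>n_0(c)$ and $n^{-c}<\eta<1/2$. **Theorem 1.** There is a constant $C>0$ with the following property. Let $d$ and $F$ be as above and suppose that the second moment matrix $\Delta=\mathbb E[X_1X_1^\top]$, $X_1\sim F$, has rank $d$ (its eigenvalues need not be distinct). For each $n$ let $(X,A)\sim\mathrm{RDPG}(F)$ on $n$ vertices, and let $E_n$ be the event that for every adjacency spectral embedding $\hat X$ of $A$ into $\mathbb R^d$ there is an orthogonal matrix $W\in\mathbb R^{d\times d}$ with $$\|\hat X-XW\|_{2\to\infty}=\max_{1\le i\le n}\|\hat X_i-W^\top X_i\|\le\frac{C\,d^{1/2}\log^2 n}{\sqrt n},$$ where $X_i$, $\hat X_i$ are the rows of $X$, $\hat X$ written as column vectors. Then $E_n$ occurs asymptotically almost surely ($n_0(c)$ may depend on $F$). -/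

import Mathlib

open MeasureTheory ProbabilityTheory
open scoped Matrix RealInnerProductSpace

/-- `F` is a probability distribution on (i.e. carried by) a set `𝒳 ⊆ ℝ^d` all of whose pairwise
inner products lie in `[0,1]`. -/
def IsLatentDistribution {d : ℕ} (F : Measure (EuclideanSpace ℝ (Fin d))) : Prop :=
  IsProbabilityMeasure F ∧
    ∃ 𝒳 : Set (EuclideanSpace ℝ (Fin d)),
      (∀ x ∈ 𝒳, ∀ y ∈ 𝒳, ⟪x, y⟫ ∈ Set.Icc (0 : ℝ) 1) ∧ ∀ᵐ x ∂F, x ∈ 𝒳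

/-- The second moment matrix `Δ = E[X₁ X₁ᵀ]` of a random vector `X₁ ∼ F`. -/
noncomputable def secondMoment {d : ℕ} (F : Measure (EuclideanSpace ℝ (Fin d))) :
    Matrix (Fin d) (Fin d) ℝ :=
  Matrix.of fun k l => ∫ x, x k * x l ∂F

/-- `(X, A) ∼ RDPG(F)` on `n` vertices: the latent positions `X₁, …, Xₙ` are i.i.d. with law `F`,
`A` is a random symmetric hollow `0/1` matrix, and conditionally on `X` the probability of `A = a`
is the product over `i > j` of `⟨Xᵢ, Xⱼ⟩` (if `aᵢⱼ = 1`) or `1 - ⟨Xᵢ, Xⱼ⟩` (if `aᵢⱼ = 0`). -/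
structure IsRDPG {d n : ℕ} {Ω : Type*} [MeasurableSpace Ω]
    (F : Measure (EuclideanSpace ℝ (Fin d))) (μ : Measure Ω)
    (X : Fin n → Ω → EuclideanSpace ℝ (Fin d)) (A : Ω → Matrix (Fin n) (Fin n) ℝ) : Prop where
  measurable_position : ∀ i, Measurable (X i)
  map_position : ∀ i, μ.map (X i) = F
  indep : iIndepFun X μ
  measurable_entry : ∀ i j, Measurable fun ω => A ω i j
  isAdjMatrix : ∀ ω, (A ω).IsAdjMatrix
  condProb_eq : ∀ a : Matrix (Fin n) (Fin n) ℝ, a.IsAdjMatrix →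
    μ⟦{ω | A ω = a} | MeasurableSpace.comap (fun ω i => X i ω) inferInstance⟧ =ᵐ[μ]
      fun ω => ∏ i, ∏ j ∈ Finset.Iio i,
        if a i j = 1 then ⟪X i ω, X j ω⟫ else 1 - ⟪X i ω, X j ω⟫

/-- The `n × d` matrix whose rows are the latent positions. -/
def positionMatrix {d n : ℕ} {Ω : Type*} (X : Fin n → Ω → EuclideanSpace ℝ (Fin d)) (ω : Ω) :
    Matrix (Fin n) (Fin d) ℝ :=
  Matrix.of fun i k => X i ω k

open scoped MatrixOrder in
/-- `|A| = (Aᵀ A)^{1/2}`, the positive semidefinite square root. -/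
noncomputable def matrixAbs {n : ℕ} (A : Matrix (Fin n) (Fin n) ℝ) : Matrix (Fin n) (Fin n) ℝ :=
  CFC.sqrt (Aᵀ * A)

/-- `Xhat` is an adjacency spectral embedding of `A` into `ℝ^d`: there is a spectral decomposition
`|A| = V diag(s) Vᵀ` with `V` orthogonal and `s₁ ≥ s₂ ≥ ⋯ ≥ sₙ` such that
`Xhat = U_A S_A^{1/2}`, where `U_A` consists of the first `d` columns of `V` and
`S_A = diag(s₁, …, s_d)`. (Eigenvectors are not unique, hence a predicate.) -/
def IsASE {n : ℕ} (d : ℕ) (A : Matrix (Fin n) (Fin n) ℝ) (Xhat : Matrix (Fin n) (Fin d) ℝ) :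
    Prop :=
  ∃ (h : d ≤ n) (V : Matrix (Fin n) (Fin n) ℝ) (s : Fin n → ℝ),
    V ∈ Matrix.orthogonalGroup (Fin n) ℝ ∧ Antitone s ∧
      matrixAbs A = V * Matrix.diagonal s * Vᵀ ∧
      Xhat = V.submatrix id (Fin.castLE h) * Matrix.diagonal fun k => √(s (Fin.castLE h k))

/-- The `2 → ∞` norm: the largest Euclidean norm of a row. -/
noncomputable def twoToInftyNorm {n d : ℕ} (M : Matrix (Fin n) (Fin d) ℝ) : ℝ :=
  ⨆ i, ‖WithLp.toLp 2 (M i)‖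

/-- The events `E n` occur asymptotically almost surely: for every `c > 0` there is `n₀` such that
`P(E n) ≥ 1 - η` whenever `n > n₀` and `n^{-c} < η < 1/2`. -/
def OccursAAS {Ω : ℕ → Type*} [∀ n, MeasurableSpace (Ω n)] (μ : ∀ n, Measure (Ω n))
    (E : ∀ n, Set (Ω n)) : Prop :=
  ∀ c : ℝ, 0 < c → ∃ n₀ : ℕ, ∀ n : ℕ, n₀ < n → ∀ η : ℝ,
    (n : ℝ) ^ (-c) < η → η < 1 / 2 → 1 - η ≤ (μ n).real (E n)

/-! ### Positive semidefinite square roots and `|A|` -/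

section SquareRoot

open scoped MatrixOrder

/-! Write A = XXᵀ + E. The argument separates a deterministic perturbation bound from scalar
Hoeffding bounds; no matrix concentration is needed.

Let Z = Uσ^{1/2} be the embedding, Q = Uσ^{-1/2} and S = σ⁻¹, where AU = Uσ. Then Z = AQ = XM + D
with M = XᵀQ and D = EQ. Since Q = ZS, the error satisfies D = (EXM + ED)S. When σ is of order n and
E acts with norm at most a small multiple of n, the term ED is absorbed and controls ‖D‖ in
Frobenius norm; feeding this back into a single row, with rows of E of norm at most √n, controls
each row of D. Moreover QᵀZ = 1 gives MᵀM − 1 = −QᵀD, so M is near its polar factor W, and Z − XW =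
D + X(M − W). This is `exists_orthogonal_row_error_le`; no eigengap between the d leading
eigenvalues enters.

The action of E is controlled through ‖EB‖² ≤ ‖E²‖‖B‖² in Frobenius norm. The entries of E² are at
most n on the diagonal and O(√n log n) off it, so the norm of E is o(n). As XXᵀ is positive
semidefinite, the top eigenvectors of |A| are then eigenvectors of A with positive eigenvalues
(`IsASE.exists_eigenvectors`).

Given X the edges are independent, so the entries of EX and of E² are, up to boundedly many terms or
on the diagonal, Hoeffding sums (`edgeLaw_abs_row_sum_ge_le`, `edgeLaw_abs_sum_mul_ge_le`).
`IsRDPG.measureReal_le_of_edgeLaw_le` removes the conditioning. Deviations of size √n log n give an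
error of order log n/√n, and the spare factor log n absorbs every constant depending on F. -/

theorem Matrix.PosSemidef.exists_sq_eq {m : Type*} [Fintype m] [DecidableEq m]
    {H : Matrix m m ℝ} (hH : H.PosSemidef) :
    ∃ R : Matrix m m ℝ, R.PosSemidef ∧ R * R = H :=
  ⟨CFC.sqrt H, Matrix.nonneg_iff_posSemidef.1 (CFC.sqrt_nonneg H),
    CFC.sqrt_mul_sqrt_self H (Matrix.nonneg_iff_posSemidef.2 hH)⟩

theorem matrixAbs_posSemidef {n : ℕ} (A : Matrix (Fin n) (Fin n) ℝ) :
    (matrixAbs A).PosSemidef :=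
  Matrix.nonneg_iff_posSemidef.1 (CFC.sqrt_nonneg _)

theorem matrixAbs_mul_self {n : ℕ} (A : Matrix (Fin n) (Fin n) ℝ) :
    matrixAbs A * matrixAbs A = Aᵀ * A := by
  refine CFC.sqrt_mul_sqrt_self _ (Matrix.nonneg_iff_posSemidef.2 ?_)
  simpa using Matrix.posSemidef_conjTranspose_mul_self A

end SquareRoot

/-! ### Frobenius norm inequalities and the polar factor -/

section Frobenius

open scoped Matrix.Norms.Frobenius

variable {l m n : Type*} [Fintype l] [Fintype m] [Fintype n]

theorem frobenius_norm_sq_eq_sum (B : Matrix m n ℝ) : ‖B‖ ^ 2 = ∑ i, ∑ j, B i j ^ 2 := by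
  have h : 0 ≤ ∑ i, ∑ j, B i j ^ 2 := by positivity
  rw [Matrix.frobenius_norm_def]
  simp only [Real.rpow_two, Real.norm_eq_abs, sq_abs]
  rw [← Real.sqrt_eq_rpow, Real.sq_sqrt h]

theorem trace_transpose_mul_eq_sum (B C : Matrix m n ℝ) :
    (Bᵀ * C).trace = ∑ i, ∑ j, B i j * C i j := by
  simp only [Matrix.trace, Matrix.diag_apply, Matrix.mul_apply, Matrix.transpose_apply]
  exact Finset.sum_comm

theorem frobenius_norm_sq_eq_trace (B : Matrix m n ℝ) : ‖B‖ ^ 2 = (Bᵀ * B).trace := by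
  rw [frobenius_norm_sq_eq_sum, trace_transpose_mul_eq_sum]
  simp only [sq]

theorem abs_trace_transpose_mul_le (B C : Matrix m n ℝ) : |(Bᵀ * C).trace| ≤ ‖B‖ * ‖C‖ := by
  refine abs_le_of_sq_le_sq ?_ (by positivity)
  rw [mul_pow, frobenius_norm_sq_eq_sum, frobenius_norm_sq_eq_sum, trace_transpose_mul_eq_sum]
  simp only [← Fintype.sum_prod_type']
  exact Finset.sum_mul_sq_le_sq_mul_sq Finset.univ (fun p : m × n => B p.1 p.2)
    fun p => C p.1 p.2

theorem frobenius_norm_mul_diagonal_le [DecidableEq n] (B : Matrix m n ℝ) {r : n → ℝ} {c : ℝ}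
    (hc : 0 ≤ c) (hr : ∀ k, |r k| ≤ c) : ‖B * Matrix.diagonal r‖ ≤ ‖B‖ * c := by
  refine le_of_sq_le_sq ?_ (by positivity)
  rw [mul_pow, frobenius_norm_sq_eq_sum, frobenius_norm_sq_eq_sum]
  simp only [Matrix.mul_diagonal, Finset.sum_mul, mul_pow]
  refine Finset.sum_le_sum fun i _ => Finset.sum_le_sum fun j _ => ?_
  refine mul_le_mul_of_nonneg_left ?_ (sq_nonneg _)
  exact sq_le_sq' (neg_le_of_abs_le (hr j)) (le_of_abs_le (hr j))

/-- Cauchy–Schwarz applied to ⟨EB, EB⟩ = ⟨B, E²B⟩. This replaces an operator norm bound for E: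
passing to E² first exploits cancellation that the Frobenius norm of E itself does not see. -/
theorem frobenius_norm_symm_mul_sq_le {E : Matrix m m ℝ} (hE : Eᵀ = E) (B : Matrix m n ℝ) :
    ‖E * B‖ ^ 2 ≤ ‖E * E‖ * ‖B‖ ^ 2 := by
  have h : (E * B)ᵀ * (E * B) = Bᵀ * (E * E * B) := by
    rw [Matrix.transpose_mul, hE]; simp only [Matrix.mul_assoc]
  rw [frobenius_norm_sq_eq_trace, h]
  calc _ ≤ ‖B‖ * ‖E * E * B‖ := (le_abs_self _).trans (abs_trace_transpose_mul_le _ _)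
    _ ≤ ‖B‖ * (‖E * E‖ * ‖B‖) := by gcongr; exact Matrix.frobenius_norm_mul _ _
    _ = _ := by ring

theorem frobenius_norm_symm_mul_le {E : Matrix m m ℝ} (hE : Eᵀ = E) {ε : ℝ} (hε : 0 ≤ ε)
    (hEE : ‖E * E‖ ≤ ε ^ 2) (B : Matrix m n ℝ) : ‖E * B‖ ≤ ε * ‖B‖ := by
  refine le_of_sq_le_sq ?_ (by positivity)
  calc _ ≤ ‖E * E‖ * ‖B‖ ^ 2 := frobenius_norm_symm_mul_sq_le hE B
    _ ≤ ε ^ 2 * ‖B‖ ^ 2 := by gcongr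
    _ = _ := by ring

theorem frobenius_norm_orthonormal_mul [DecidableEq n] {U : Matrix m n ℝ} (hU : Uᵀ * U = 1)
    (B : Matrix n l ℝ) : ‖U * B‖ = ‖B‖ := by
  rw [← sq_eq_sq₀ (norm_nonneg _) (norm_nonneg _), frobenius_norm_sq_eq_trace,
    frobenius_norm_sq_eq_trace, Matrix.transpose_mul, Matrix.mul_assoc, ← Matrix.mul_assoc Uᵀ, hU,
    Matrix.one_mul]

/-- A matrix whose Gram matrix is close to the identity is as close to its orthogonal polar
factor. -/
theorem exists_orthogonal_norm_sub_le [DecidableEq m] (M : Matrix m m ℝ)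
    (hM : ‖Mᵀ * M - 1‖ < 1) :
    ∃ W ∈ Matrix.orthogonalGroup m ℝ, ‖M - W‖ ≤ ‖Mᵀ * M - 1‖ := by
  obtain ⟨R, hR, hRR⟩ := Matrix.PosSemidef.exists_sq_eq
    (H := Mᵀ * M) (by simpa using Matrix.posSemidef_conjTranspose_mul_self M)
  have hRt : Rᵀ = R := by simpa [Matrix.IsSymm] using hR.1
  -- Neumann series: the Gram matrix is within distance 1 of the identity.
  have hunit : IsUnit (Mᵀ * M) := by
    have := Units.isUnit (Units.oneSub (1 - Mᵀ * M) (by rwa [norm_sub_rev]))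
    simpa using this
  have hRu : IsUnit R.det := by
    rw [Matrix.isUnit_iff_isUnit_det, ← hRR, Matrix.det_mul] at hunit
    exact isUnit_of_mul_isUnit_left hunit
  have hW : (M * R⁻¹)ᵀ * (M * R⁻¹) = 1 := by
    rw [Matrix.transpose_mul, Matrix.transpose_nonsing_inv, hRt, Matrix.mul_assoc,
      ← Matrix.mul_assoc Mᵀ, ← hRR, Matrix.mul_assoc, Matrix.mul_nonsing_inv _ hRu,
      Matrix.mul_one, Matrix.nonsing_inv_mul _ hRu]
  refine ⟨M * R⁻¹, (Matrix.mem_orthogonalGroup_iff' m ℝ).2 hW, ?_⟩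
  have hMW : M - M * R⁻¹ = M * R⁻¹ * (R - 1) := by
    rw [Matrix.mul_sub, Matrix.mul_one, Matrix.mul_assoc, Matrix.nonsing_inv_mul _ hRu,
      Matrix.mul_one]
  rw [hMW, frobenius_norm_orthonormal_mul hW, ← hRR]
  refine le_of_sq_le_sq ?_ (norm_nonneg _)
  have hS : (R - 1)ᵀ = R - 1 := by simp [hRt]
  -- Expanding R² − 1 = (R − 1) + R(R − 1), the cross term has nonnegative trace because R is
  -- positive semidefinite, so ‖R − 1‖ ≤ ‖R² − 1‖.
  have hfac : (R * R - 1)ᵀ * (R * R - 1) =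
      (R - 1)ᵀ * (R - 1) + ((R * (R - 1))ᵀ * (R * (R - 1)) +
        2 • ((R - 1)ᵀ * R * (R - 1))) := by
    simp only [Matrix.transpose_mul, Matrix.transpose_sub, Matrix.transpose_one, hRt]
    noncomm_ring
  have hpos : 0 ≤ ((R - 1)ᵀ * R * (R - 1)).trace := by
    have := hR.conjTranspose_mul_mul_same (R - 1)
    simpa using this.trace_nonneg
  rw [frobenius_norm_sq_eq_trace, frobenius_norm_sq_eq_trace, hfac, Matrix.trace_add,
    Matrix.trace_add, Matrix.trace_smul, ← frobenius_norm_sq_eq_trace (R * (R - 1)), two_nsmul]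
  nlinarith [sq_nonneg ‖R * (R - 1)‖]

end Frobenius

/-! ### From the embedding of `|A|` to eigenvectors of `A` -/

section SpectralEmbedding

open scoped Matrix.Norms.Frobenius

/-- The hypothesis bounds the singular values of X below by √g. On the range of X, Cauchy–Schwarz
transfers this bound to Xᵀ; applying X again supplies the second factor √g. -/
theorem mul_norm_le_norm_gram_mul {m n : Type*} [Fintype m] [Fintype n] {X : Matrix m n ℝ}
    {g : ℝ} (hg : 0 ≤ g) (hX : ∀ z : Matrix n Unit ℝ, g * ‖z‖ ^ 2 ≤ ‖X * z‖ ^ 2)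
    (z : Matrix n Unit ℝ) : g * ‖X * z‖ ≤ ‖X * Xᵀ * (X * z)‖ := by
  have hX' : ∀ z : Matrix n Unit ℝ, √g * ‖z‖ ≤ ‖X * z‖ := fun z => by
    refine le_of_sq_le_sq ?_ (norm_nonneg _)
    rw [mul_pow, Real.sq_sqrt hg]
    exact hX z
  have hy : √g * ‖X * z‖ ≤ ‖Xᵀ * (X * z)‖ := by
    have h1 : ‖X * z‖ ^ 2 ≤ ‖z‖ * ‖Xᵀ * (X * z)‖ := by
      rw [frobenius_norm_sq_eq_trace, Matrix.transpose_mul, Matrix.mul_assoc]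
      exact (le_abs_self _).trans (abs_trace_transpose_mul_le _ _)
    rcases (norm_nonneg (X * z)).eq_or_lt with h0 | h0
    · rw [← h0, mul_zero]; exact norm_nonneg _
    · have h2 := mul_le_mul_of_nonneg_left h1 (Real.sqrt_nonneg g)
      have h3 := mul_le_mul_of_nonneg_right (hX' z) (norm_nonneg (Xᵀ * (X * z)))
      refine le_of_mul_le_mul_left ?_ h0
      nlinarith
  calc g * ‖X * z‖ = √g * (√g * ‖X * z‖) := by rw [← mul_assoc, Real.mul_self_sqrt hg]
    _ ≤ √g * ‖Xᵀ * (X * z)‖ := by gcongr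
    _ ≤ ‖X * (Xᵀ * (X * z))‖ := hX' _
    _ = _ := by rw [Matrix.mul_assoc X]

/-- Weyl-type lower bound: the `d` leading eigenvalues of `|A|` are bounded below if `A` is a small
perturbation of `X Xᵀ` and the Gram matrix of `X` is bounded below. -/
theorem sub_le_eigenvalue_of_gram_le {d n : ℕ} (h : d ≤ n) {A V E : Matrix (Fin n) (Fin n) ℝ}
    {X : Matrix (Fin n) (Fin d) ℝ} {s : Fin n → ℝ} (hA : Aᵀ = A)
    (hV : V ∈ Matrix.orthogonalGroup (Fin n) ℝ) (hs : Antitone s) (hs0 : ∀ i, 0 ≤ s i)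
    (hAA : A * A = V * Matrix.diagonal (fun i => s i * s i) * Vᵀ)
    (hE : Eᵀ = E) (hAE : A = X * Xᵀ + E) {g ε : ℝ} (hg : 0 < g) (hε : 0 ≤ ε)
    (hEE : ‖E * E‖ ≤ ε ^ 2) (hX : ∀ z : Matrix (Fin d) Unit ℝ, g * ‖z‖ ^ 2 ≤ ‖X * z‖ ^ 2)
    (k : Fin d) : g - ε ≤ s (Fin.castLE h k) := by
  have hVV : V * Vᵀ = 1 := (Matrix.mem_orthogonalGroup_iff (Fin n) ℝ).1 hV
  -- Min-max by dimension count: orthogonality of Xv to the eigenvectors before k is fewer than d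
  -- conditions on v. They are padded with zero rows to a square matrix, singular because row k
  -- vanishes.
  obtain ⟨v, hv0, hv⟩ : ∃ v : Fin d → ℝ, v ≠ 0 ∧
      (Matrix.of fun i : Fin d => if i < k then (Vᵀ * X) (Fin.castLE h i) else 0) *ᵥ v = 0 := by
    rw [Matrix.exists_mulVec_eq_zero_iff]
    exact Matrix.det_eq_zero_of_row_eq_zero k fun j => by simp
  set z : Matrix (Fin d) Unit ℝ := Matrix.replicateCol Unit v with hz
  have hzpos : 0 < ‖z‖ := by
    rw [norm_pos_iff]
    intro h0
    exact hv0 (funext fun i => congrFun (congrFun h0 i) ())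
  have hypos : 0 < ‖X * z‖ := by
    have := hX z
    have h2 : 0 < g * ‖z‖ ^ 2 := by positivity
    exact lt_of_le_of_ne (norm_nonneg _) fun h0 => by
      rw [← h0] at this
      norm_num at this
      linarith
  have hc : ∀ j : Fin n, j < Fin.castLE h k → (Vᵀ * (X * z)) j () = 0 := by
    intro j hj
    have hjd : j.1 < d := lt_of_lt_of_le (Fin.lt_def.1 hj) k.2.le
    have := congrFun hv ⟨j.1, hjd⟩
    have hlt : (⟨j.1, hjd⟩ : Fin d) < k := hj
    rw [← Matrix.mul_assoc, hz]
    simpa [Matrix.mulVec, Matrix.mul_apply, dotProduct, hlt] using this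
  have hcn : ‖Vᵀ * (X * z)‖ = ‖X * z‖ :=
    frobenius_norm_orthonormal_mul (by simpa using hVV) _
  have hup : ‖A * (X * z)‖ ≤ s (Fin.castLE h k) * ‖X * z‖ := by
    refine le_of_sq_le_sq ?_ (mul_nonneg (hs0 _) (norm_nonneg _))
    have h1 : (A * (X * z))ᵀ * (A * (X * z)) =
        (Vᵀ * (X * z))ᵀ * (Matrix.diagonal (fun i => s i * s i) * (Vᵀ * (X * z))) := by
      rw [Matrix.transpose_mul, hA, Matrix.mul_assoc, ← Matrix.mul_assoc A, hAA]
      simp only [Matrix.transpose_mul, Matrix.transpose_transpose, Matrix.mul_assoc]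
    rw [frobenius_norm_sq_eq_trace, h1, trace_transpose_mul_eq_sum, mul_pow, ← hcn,
      frobenius_norm_sq_eq_sum, Finset.mul_sum]
    simp only [Finset.univ_unique, PUnit.default_eq_unit, Finset.sum_singleton,
      Matrix.diagonal_mul]
    refine Finset.sum_le_sum fun j _ => ?_
    rcases lt_or_ge j (Fin.castLE h k) with hj | hj
    · simp [hc j hj]
    · nlinarith [mul_le_mul (hs hj) (hs hj) (hs0 j) (hs0 _), sq_nonneg ((Vᵀ * (X * z)) j ())]
  have hlow : g * ‖X * z‖ ≤ ‖A * (X * z)‖ + ε * ‖X * z‖ := by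
    have h1 : X * Xᵀ * (X * z) = A * (X * z) - E * (X * z) := by
      rw [hAE, Matrix.add_mul, add_sub_cancel_right]
    calc g * ‖X * z‖ ≤ _ := mul_norm_le_norm_gram_mul hg.le hX z
      _ ≤ ‖A * (X * z)‖ + ‖E * (X * z)‖ := by rw [h1]; exact norm_sub_le _ _
      _ ≤ _ := by gcongr; exact frobenius_norm_symm_mul_le hE hε hEE _
  refine le_of_mul_le_mul_right ?_ hypos
  linarith

/-- Eigenvectors of `A²` for large eigenvalues are eigenvectors of `A` for positive eigenvalues. -/
theorem mul_eq_mul_diagonal_of_sq {m n : Type*} [Fintype m] [Fintype n] [DecidableEq n]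
    {d : Type*} [Fintype d] {A E : Matrix m m ℝ} {X : Matrix m d ℝ}
    {U : Matrix m n ℝ} {σ : n → ℝ} (hAAU : A * (A * U) = U * Matrix.diagonal (fun i => σ i * σ i))
    (hE : Eᵀ = E) (hAE : A = X * Xᵀ + E) {lam ε : ℝ} (hε : 0 ≤ ε) (hlam : ε < lam)
    (hEE : ‖E * E‖ ≤ ε ^ 2) (hσ : ∀ k, lam ≤ σ k) : A * U = U * Matrix.diagonal σ := by
  -- Y captures the part belonging to eigenvalues −σ. Its quadratic form under A is at most
  -- −lam‖Y‖², yet at least −ε‖Y‖² because XXᵀ is positive semidefinite; hence Y = 0.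
  set Y := A * U - U * Matrix.diagonal σ with hY
  have hAY : A * Y = -(Y * Matrix.diagonal σ) := by
    rw [hY, Matrix.mul_sub, Matrix.sub_mul, hAAU, Matrix.mul_assoc U, Matrix.diagonal_mul_diagonal,
      Matrix.mul_assoc A]
    abel
  have h1 : (Yᵀ * (A * Y)).trace ≤ -(lam * ‖Y‖ ^ 2) := by
    rw [hAY, Matrix.mul_neg, Matrix.trace_neg, trace_transpose_mul_eq_sum,
      frobenius_norm_sq_eq_sum, Finset.mul_sum]
    simp only [Finset.mul_sum, Matrix.mul_diagonal]
    refine neg_le_neg (Finset.sum_le_sum fun i _ => Finset.sum_le_sum fun j _ => ?_)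
    nlinarith [hσ j, sq_nonneg (Y i j)]
  have h2 : -(ε * ‖Y‖ ^ 2) ≤ (Yᵀ * (A * Y)).trace := by
    have h3 : Yᵀ * (A * Y) = (Xᵀ * Y)ᵀ * (Xᵀ * Y) + Yᵀ * (E * Y) := by
      rw [hAE, Matrix.add_mul, Matrix.mul_add, Matrix.transpose_mul, Matrix.transpose_transpose]
      simp only [Matrix.mul_assoc]
    rw [h3, Matrix.trace_add, ← frobenius_norm_sq_eq_trace]
    have h4 := neg_le_of_abs_le (abs_trace_transpose_mul_le Y (E * Y))
    have h5 := mul_le_mul_of_nonneg_left (frobenius_norm_symm_mul_le hE hε hEE Y) (norm_nonneg Y)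
    nlinarith [sq_nonneg ‖Xᵀ * Y‖]
  have h6 : ‖Y‖ ^ 2 = 0 := by nlinarith [sq_nonneg ‖Y‖]
  exact sub_eq_zero.1 (norm_eq_zero.1 (pow_eq_zero_iff two_ne_zero |>.1 h6))

/-- The columns of V diagonalise A², which forgets signs. The condition 2ε < g places the leading
eigenvalues, at least g − ε, above ε, where no negative eigenvalue of A can interfere. -/
theorem IsASE.exists_eigenvectors {d n : ℕ} {A E : Matrix (Fin n) (Fin n) ℝ}
    {X Xhat : Matrix (Fin n) (Fin d) ℝ} (hXhat : IsASE d A Xhat) (hA : Aᵀ = A)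
    (hAE : A = X * Xᵀ + E) {g ε : ℝ} (hε : 0 ≤ ε) (hεg : 2 * ε < g)
    (hEE : ‖E * E‖ ≤ ε ^ 2) (hX : ∀ z : Matrix (Fin d) Unit ℝ, g * ‖z‖ ^ 2 ≤ ‖X * z‖ ^ 2) :
    ∃ (U : Matrix (Fin n) (Fin d) ℝ) (σ : Fin d → ℝ), Uᵀ * U = 1 ∧ (∀ k, g - ε ≤ σ k) ∧
      A * U = U * Matrix.diagonal σ ∧ Xhat = U * Matrix.diagonal fun k => √(σ k) := by
  obtain ⟨h, V, s, hV, hs, habs, rfl⟩ := hXhat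
  have hVV : Vᵀ * V = 1 := (Matrix.mem_orthogonalGroup_iff' (Fin n) ℝ).1 hV
  have hE : Eᵀ = E := by
    have : E = A - X * Xᵀ := by rw [hAE]; abel
    rw [this, Matrix.transpose_sub, hA, Matrix.transpose_mul, Matrix.transpose_transpose]
  have hAA : A * A = V * Matrix.diagonal (fun i => s i * s i) * Vᵀ := by
    have := matrixAbs_mul_self A
    rw [hA] at this
    rw [← this, habs, ← Matrix.diagonal_mul_diagonal]
    calc _ = V * Matrix.diagonal s * (Vᵀ * V) * Matrix.diagonal s * Vᵀ := by
          simp only [Matrix.mul_assoc]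
      _ = _ := by rw [hVV]; simp only [Matrix.mul_assoc, Matrix.one_mul]
  have hs0 : ∀ i, 0 ≤ s i := by
    have h1 := (matrixAbs_posSemidef A).conjTranspose_mul_mul_same V
    have h2 : Vᴴ * matrixAbs A * V = Matrix.diagonal s := by
      rw [habs, Matrix.conjTranspose_eq_transpose_of_trivial]
      calc _ = (Vᵀ * V) * Matrix.diagonal s * (Vᵀ * V) := by simp only [Matrix.mul_assoc]
        _ = _ := by rw [hVV, Matrix.one_mul, Matrix.mul_one]
    rw [h2, Matrix.posSemidef_diagonal_iff] at h1
    exact h1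
  have hlow := sub_le_eigenvalue_of_gram_le h hA hV hs hs0 hAA hE hAE (by linarith) hε hEE hX
  have hAAV : A * A * V = V * Matrix.diagonal (fun i => s i * s i) := by
    rw [hAA, Matrix.mul_assoc, hVV, Matrix.mul_one]
  refine ⟨V.submatrix id (Fin.castLE h), fun k => s (Fin.castLE h k), ?_, hlow, ?_, rfl⟩
  · ext i j
    have := congrFun (congrFun hVV (Fin.castLE h i)) (Fin.castLE h j)
    simpa [Matrix.mul_apply, Matrix.one_apply] using this
  · refine mul_eq_mul_diagonal_of_sq ?_ hE hAE hε (by linarith : ε < g - ε) hEE hlow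
    rw [← Matrix.mul_assoc]
    ext i k
    have := congrFun (congrFun hAAV i) (Fin.castLE h k)
    rw [Matrix.mul_diagonal] at this ⊢
    simpa [Matrix.mul_apply] using this

end SpectralEmbedding

/-! ### Row norms of products -/

section RowBounds

open scoped Matrix.Norms.Frobenius

variable {l m n : Type*} [Fintype n]

theorem norm_row_mul_le [Fintype m] (B : Matrix l m ℝ) (C : Matrix m n ℝ) (i : l) :
    ‖WithLp.toLp 2 ((B * C) i)‖ ≤ ‖WithLp.toLp 2 (B i)‖ * ‖C‖ := by
  have h : Matrix.replicateRow Unit ((B * C) i) = Matrix.replicateRow Unit (B i) * C := by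
    ext _ j
    simp [Matrix.mul_apply]
  rw [← Matrix.frobenius_norm_replicateRow (ι := Unit), h,
    ← Matrix.frobenius_norm_replicateRow (ι := Unit) (B i)]
  exact Matrix.frobenius_norm_mul _ _

theorem norm_row_mul_diagonal_le [DecidableEq n] (B : Matrix m n ℝ) {r : n → ℝ} {c : ℝ}
    (hc : 0 ≤ c) (hr : ∀ k, |r k| ≤ c) (i : m) :
    ‖WithLp.toLp 2 ((B * Matrix.diagonal r) i)‖ ≤ ‖WithLp.toLp 2 (B i)‖ * c := by
  have h : Matrix.replicateRow Unit ((B * Matrix.diagonal r) i) =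
      Matrix.replicateRow Unit (B i) * Matrix.diagonal r := by
    ext _ j
    simp [Matrix.mul_diagonal]
  rw [← Matrix.frobenius_norm_replicateRow (ι := Unit), h,
    ← Matrix.frobenius_norm_replicateRow (ι := Unit) (B i)]
  exact frobenius_norm_mul_diagonal_le _ hc hr

theorem norm_row_add_le (B C : Matrix m n ℝ) (i : m) :
    ‖WithLp.toLp 2 ((B + C) i)‖ ≤ ‖WithLp.toLp 2 (B i)‖ + ‖WithLp.toLp 2 (C i)‖ :=
  norm_add_le (WithLp.toLp 2 (B i)) (WithLp.toLp 2 (C i))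

theorem frobenius_norm_le_of_row_le [Fintype m] (B : Matrix m n ℝ) {c : ℝ} (hc : 0 ≤ c)
    (h : ∀ i, ‖WithLp.toLp 2 (B i)‖ ≤ c) : ‖B‖ ≤ √(Fintype.card m) * c := by
  refine le_of_sq_le_sq ?_ (by positivity)
  rw [frobenius_norm_sq_eq_sum, mul_pow, Real.sq_sqrt (by positivity)]
  calc ∑ i, ∑ j, B i j ^ 2 = ∑ i, ‖WithLp.toLp 2 (B i)‖ ^ 2 := by
        simp [EuclideanSpace.norm_sq_eq]
    _ ≤ ∑ _i : m, c ^ 2 := by gcongr with i; exact h i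
    _ = _ := by simp

theorem norm_row_le_of_entry_le (B : Matrix m n ℝ) {c : ℝ} (hc : 0 ≤ c) (i : m)
    (h : ∀ j, |B i j| ≤ c) : ‖WithLp.toLp 2 (B i)‖ ≤ √(Fintype.card n) * c := by
  refine le_of_sq_le_sq ?_ (by positivity)
  rw [EuclideanSpace.norm_sq_eq, mul_pow, Real.sq_sqrt (by positivity)]
  calc ∑ j, ‖B i j‖ ^ 2 ≤ ∑ _j : n, c ^ 2 := by gcongr with j; exact h j
    _ = _ := by simp

end RowBounds

/-! ### Deterministic row-wise embedding error -/

section EmbeddingError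

open scoped Matrix.Norms.Frobenius

/-- Deterministic row-wise error bound for a scaled eigenvector matrix of `A = X Xᵀ + E`. -/
theorem exists_orthogonal_row_error_le {d n : ℕ} (hn : 0 < n) {A E : Matrix (Fin n) (Fin n) ℝ}
    {X U : Matrix (Fin n) (Fin d) ℝ} {σ : Fin d → ℝ} (hE : Eᵀ = E) (hAE : A = X * Xᵀ + E)
    (hU : Uᵀ * U = 1) (hAU : A * U = U * Matrix.diagonal σ)
    {κ ε τ : ℝ} (hκ : 0 < κ) (hε : 0 ≤ ε) (hτ : 0 ≤ τ) (hσ : ∀ k, κ * n ≤ σ k)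
    (hεκ : 2 * ε ≤ κ * n) (hEE : ‖E * E‖ ≤ ε ^ 2)
    (hX : ∀ i, ‖WithLp.toLp 2 (X i)‖ ≤ 1) (hEX : ∀ i, ‖WithLp.toLp 2 ((E * X) i)‖ ≤ τ)
    (hErow : ∀ i, ‖WithLp.toLp 2 (E i)‖ ≤ √n)
    {ρ : ℝ} (hρ : ρ = √d / √κ) (hsmall : τ / n * (2 * ρ ^ 2 / κ) < 1) :
    ∃ W ∈ Matrix.orthogonalGroup (Fin d) ℝ, ∀ i,
      ‖WithLp.toLp 2 (((U * Matrix.diagonal fun k => √(σ k)) - X * W) i)‖ ≤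
        τ / n * (ρ / κ + 2 * ρ / κ ^ 2 + 2 * ρ ^ 2 / κ) := by
  have hN : (0 : ℝ) < n := by exact_mod_cast hn
  have hlam : 0 < κ * n := by positivity
  have hσ0 : ∀ k, 0 < σ k := fun k => hlam.trans_le (hσ k)
  have hρ0 : 0 ≤ ρ := by rw [hρ]; positivity
  set r : Fin d → ℝ := fun k => (√(σ k))⁻¹ with hr
  set S : Matrix (Fin d) (Fin d) ℝ := Matrix.diagonal fun k => (σ k)⁻¹ with hS
  set Z := U * Matrix.diagonal fun k => √(σ k) with hZ
  set Q := U * Matrix.diagonal r with hQ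
  set M := Xᵀ * Q with hM
  set D := E * Q with hD
  have hsq : ∀ k, √(σ k) * √(σ k) = σ k := fun k => Real.mul_self_sqrt (hσ0 k).le
  have hsqpos : ∀ k, 0 < √(σ k) := fun k => Real.sqrt_pos.2 (hσ0 k)
  have hAQ : A * Q = Z := by
    rw [hQ, hZ, ← Matrix.mul_assoc, hAU, Matrix.mul_assoc, Matrix.diagonal_mul_diagonal]
    congr 2; ext k
    have := hsqpos k
    rw [hr]; field_simp; rw [sq]; exact (hsq k).symm
  have hZQ : Z * S = Q := by
    rw [hQ, hZ, hS, Matrix.mul_assoc, Matrix.diagonal_mul_diagonal]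
    congr 2; ext k
    have h1 := hsqpos k
    have h2 := hσ0 k
    rw [hr]; field_simp; rw [sq]; exact hsq k
  have hZD : Z = X * M + D := by
    rw [← hAQ, hAE, Matrix.add_mul, hM, hD, Matrix.mul_assoc]
  -- The self-consistent equation for D: substitute Q = ZS and then Z = XM + D.
  have hDeq : D = (E * X * M + E * D) * S := by
    conv_lhs => rw [hD, ← hZQ, hZD]
    simp only [Matrix.mul_add, Matrix.add_mul, Matrix.mul_assoc]
  have hSle : ∀ k, |(σ k)⁻¹| ≤ (κ * n)⁻¹ := fun k => by
    rw [abs_of_pos (inv_pos.2 (hσ0 k))]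
    exact inv_anti₀ hlam (hσ k)
  have hQn : √n * ‖Q‖ ≤ ρ := by
    rw [hQ, frobenius_norm_orthonormal_mul hU]
    refine le_of_sq_le_sq ?_ hρ0
    rw [mul_pow, Real.sq_sqrt hN.le, Matrix.frobenius_norm_diagonal, EuclideanSpace.norm_sq_eq,
      hρ, div_pow, Real.sq_sqrt hκ.le, Real.sq_sqrt (by positivity)]
    have h1 : ∀ k, ‖r k‖ ^ 2 ≤ (κ * n)⁻¹ := fun k => by
      rw [hr]
      simp only [Real.norm_eq_abs, sq_abs, inv_pow, Real.sq_sqrt (hσ0 k).le]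
      exact inv_anti₀ hlam (hσ k)
    calc (n : ℝ) * ∑ k, ‖r k‖ ^ 2 ≤ n * ∑ _k : Fin d, (κ * n)⁻¹ := by gcongr with k; exact h1 k
      _ = _ := by simp; field_simp
  have hXn : ‖X‖ ≤ √n := by simpa using frobenius_norm_le_of_row_le X zero_le_one hX
  have hMn : ‖M‖ ≤ ρ := by
    calc ‖M‖ ≤ ‖Xᵀ‖ * ‖Q‖ := Matrix.frobenius_norm_mul _ _
      _ ≤ √n * ‖Q‖ := by rw [Matrix.frobenius_norm_transpose]; gcongr
      _ ≤ ρ := hQn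
  have hEXn : ‖E * X‖ ≤ √n * τ := by simpa using frobenius_norm_le_of_row_le _ hτ hEX
  have hDn : ‖D‖ ≤ 2 * (√n * τ * ρ) / (κ * n) := by
    -- Since 2ε ≤ κn, the term in ‖D‖ on the right is absorbed into the left at the cost of a factor
    -- 2.
    have h1 : ‖D‖ ≤ (√n * τ * ρ + ε * ‖D‖) * (κ * n)⁻¹ := by
      conv_lhs => rw [hDeq]
      refine (frobenius_norm_mul_diagonal_le _ (inv_nonneg.2 hlam.le) hSle).trans ?_
      gcongr
      refine (norm_add_le _ _).trans (add_le_add ?_ (frobenius_norm_symm_mul_le hE hε hEE D))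
      exact (Matrix.frobenius_norm_mul _ _).trans (by gcongr)
    rw [← div_eq_mul_inv, le_div_iff₀ hlam] at h1
    rw [le_div_iff₀ hlam]
    nlinarith [norm_nonneg D]
  have hMM : Mᵀ * M - 1 = -(Qᵀ * D) := by
    have h1 : Qᵀ * Z = 1 := by
      rw [hQ, hZ, Matrix.transpose_mul, Matrix.diagonal_transpose, Matrix.mul_assoc,
        ← Matrix.mul_assoc Uᵀ, hU, Matrix.one_mul, Matrix.diagonal_mul_diagonal,
        ← Matrix.diagonal_one]
      congr 1; ext k
      exact inv_mul_cancel₀ (hsqpos k).ne'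
    have h2 : Mᵀ * M = Qᵀ * (X * M) := by
      rw [hM, Matrix.transpose_mul, Matrix.transpose_transpose, Matrix.mul_assoc]
    rw [h2, ← h1, hZD, Matrix.mul_add]
    abel
  have hMMn : ‖Mᵀ * M - 1‖ ≤ τ / n * (2 * ρ ^ 2 / κ) := by
    rw [hMM, norm_neg]
    calc ‖Qᵀ * D‖ ≤ ‖Qᵀ‖ * ‖D‖ := Matrix.frobenius_norm_mul _ _
      _ ≤ ‖Q‖ * (2 * (√n * τ * ρ) / (κ * n)) := by
        rw [Matrix.frobenius_norm_transpose]; gcongr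
      _ = √n * ‖Q‖ * (2 * τ * ρ / (κ * n)) := by ring
      _ ≤ ρ * (2 * τ * ρ / (κ * n)) := by gcongr
      _ = _ := by field_simp
  obtain ⟨W, hW, hMW⟩ := exists_orthogonal_norm_sub_le M (hMMn.trans_lt hsmall)
  refine ⟨W, hW, fun i => ?_⟩
  have hsplit : Z - X * W = D + X * (M - W) := by
    rw [hZD, Matrix.mul_sub]; abel
  have hDi : ‖WithLp.toLp 2 (D i)‖ ≤ τ / n * (ρ / κ + 2 * ρ / κ ^ 2) := by
    -- Second use of the equation, now in one row: the global bound on ‖D‖ offsets the factor √n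
    -- from the row of E.
    have h1 : ‖WithLp.toLp 2 ((E * X * M + E * D) i)‖ ≤
        τ * ρ + √n * (2 * (√n * τ * ρ) / (κ * n)) := by
      refine (norm_row_add_le _ _ i).trans (add_le_add ?_ ?_)
      · exact (norm_row_mul_le _ _ i).trans (mul_le_mul (hEX i) hMn (norm_nonneg _) hτ)
      · exact (norm_row_mul_le _ _ i).trans
          (mul_le_mul (hErow i) hDn (norm_nonneg _) (Real.sqrt_nonneg _))
    calc ‖WithLp.toLp 2 (D i)‖ = ‖WithLp.toLp 2 (((E * X * M + E * D) * S) i)‖ := by rw [← hDeq]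
      _ ≤ _ := norm_row_mul_diagonal_le _ (inv_nonneg.2 hlam.le) hSle i
      _ ≤ (τ * ρ + √n * (2 * (√n * τ * ρ) / (κ * n))) * (κ * n)⁻¹ := by gcongr
      _ = (τ * ρ + (√n * √n) * (2 * (τ * ρ) / (κ * n))) * (κ * n)⁻¹ := by ring
      _ = _ := by rw [Real.mul_self_sqrt hN.le]; field_simp
  rw [hsplit]
  calc _ ≤ ‖WithLp.toLp 2 (D i)‖ + ‖WithLp.toLp 2 ((X * (M - W)) i)‖ := norm_row_add_le _ _ i
    _ ≤ τ / n * (ρ / κ + 2 * ρ / κ ^ 2) + τ / n * (2 * ρ ^ 2 / κ) := by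
      refine add_le_add hDi ((norm_row_mul_le _ _ i).trans ?_)
      calc _ ≤ 1 * ‖M - W‖ := by gcongr; exact hX i
        _ ≤ _ := by rw [one_mul]; exact hMW.trans hMMn
    _ = _ := by ring

/-- Row-wise error bound for an adjacency spectral embedding of a perturbation of `X Xᵀ`. -/
theorem IsASE.exists_orthogonal_twoToInftyNorm_le {d n : ℕ} (hn : 0 < n)
    {A : Matrix (Fin n) (Fin n) ℝ} {X Xhat : Matrix (Fin n) (Fin d) ℝ} (hXhat : IsASE d A Xhat)
    (hA : Aᵀ = A) {κ ε t : ℝ} (hκ : 0 < κ) (hε : 0 ≤ ε) (ht : 0 ≤ t)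
    (hεκ : 2 * ε ≤ κ * n)
    (hEE : ‖(A - X * Xᵀ) * (A - X * Xᵀ)‖ ≤ ε ^ 2)
    (hX : ∀ i, ‖WithLp.toLp 2 (X i)‖ ≤ 1)
    (hgram : ∀ z : Matrix (Fin d) Unit ℝ, 2 * κ * n * ‖z‖ ^ 2 ≤ ‖X * z‖ ^ 2)
    (hEX : ∀ i k, |((A - X * Xᵀ) * X) i k| ≤ t) (hEle : ∀ i j, |(A - X * Xᵀ) i j| ≤ 1)
    {ρ : ℝ} (hρ : ρ = √d / √κ) (hsmall : √d * t / n * (2 * ρ ^ 2 / κ) < 1) :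
    ∃ W ∈ Matrix.orthogonalGroup (Fin d) ℝ, twoToInftyNorm (Xhat - X * W) ≤
        √d * t / n * (ρ / κ + 2 * ρ / κ ^ 2 + 2 * ρ ^ 2 / κ) := by
  have hN : (0 : ℝ) < n := by exact_mod_cast hn
  have hlam : 0 < κ * n := by positivity
  have hAE : A = X * Xᵀ + (A - X * Xᵀ) := by abel
  have hE : (A - X * Xᵀ)ᵀ = A - X * Xᵀ := by
    rw [Matrix.transpose_sub, hA, Matrix.transpose_mul, Matrix.transpose_transpose]
  obtain ⟨U, σ, hU, hσ, hAU, rfl⟩ :=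
    hXhat.exists_eigenvectors hA hAE hε (by nlinarith) hEE hgram
  obtain ⟨W, hW, hle⟩ := exists_orthogonal_row_error_le hn hE hAE hU hAU hκ hε
    (by positivity : 0 ≤ √d * t) (fun k => by linarith [hσ k]) hεκ hEE hX
    (fun i => by simpa using norm_row_le_of_entry_le _ ht i (hEX i))
    (fun i => by simpa using norm_row_le_of_entry_le _ zero_le_one i (hEle i)) hρ hsmall
  have : Nonempty (Fin n) := ⟨⟨0, hn⟩⟩
  exact ⟨W, hW, ciSup_le hle⟩

end EmbeddingError

/-! ### Sub-Gaussian tails -/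

section SubGaussian

variable {Ω : Type*} {mΩ : MeasurableSpace Ω} {μ : Measure Ω}

theorem hasSubgaussianMGF_mono {Y : Ω → ℝ} {c c' : NNReal} (h : HasSubgaussianMGF Y c μ)
    (hc : c ≤ c') : HasSubgaussianMGF Y c' μ where
  integrable_exp_mul := h.integrable_exp_mul
  mgf_le t := (h.mgf_le t).trans (by gcongr)

theorem measureReal_abs_ge_le_of_hasSubgaussianMGF [IsFiniteMeasure μ] {Y : Ω → ℝ} {c : NNReal}
    (h : HasSubgaussianMGF Y c μ) {t : ℝ} (ht : 0 ≤ t) :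
    μ.real {ω | t ≤ |Y ω|} ≤ 2 * Real.exp (-t ^ 2 / (2 * c)) := by
  have hsub : {ω | t ≤ |Y ω|} ⊆ {ω | t ≤ Y ω} ∪ {ω | t ≤ (-Y) ω} := fun ω hω => by
    simpa [le_abs] using hω
  calc μ.real {ω | t ≤ |Y ω|} ≤ μ.real ({ω | t ≤ Y ω} ∪ {ω | t ≤ (-Y) ω}) :=
        measureReal_mono hsub
    _ ≤ μ.real {ω | t ≤ Y ω} + μ.real {ω | t ≤ (-Y) ω} := measureReal_union_le _ _
    _ ≤ _ := by
      rw [two_mul]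
      exact add_le_add (h.measure_ge_le ht) (h.neg.measure_ge_le ht)

end SubGaussian

/-! ### Hoeffding bounds on products of Boolean spaces -/

section ProductOfBool

variable {ι : Type*} [Fintype ι] (p : ι → Measure Bool) [∀ i, IsProbabilityMeasure (p i)]

theorem indepFun_pi_of_dependsOn {Y Z : (ι → Bool) → ℝ} {S T : Finset ι} (hST : Disjoint S T)
    (hY : DependsOn Y S) (hZ : DependsOn Z T) : IndepFun Y Z (Measure.pi p) := by
  have hind : iIndepFun (fun (i : ι) (b : ι → Bool) => b i) (Measure.pi p) :=
    iIndepFun_pi (X := fun _ => id) fun _ => aemeasurable_id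
  have h := hind.indepFun_finset S T hST fun i => measurable_pi_apply i
  obtain ⟨f, rfl⟩ := (dependsOn_iff_exists_comp).1 hY
  obtain ⟨g, rfl⟩ := (dependsOn_iff_exists_comp).1 hZ
  exact h.comp (φ := f) (ψ := g) (measurable_of_countable f) (measurable_of_countable g)

variable {J : Type*} {Z : J → (ι → Bool) → ℝ} {S : J → Finset ι}

/-- Induction on the index set: the partial sum depends only on the union of the earlier blocks, so
it is independent of the next term and the variance proxies add. -/
theorem hasSubgaussianMGF_sum_pi_of_dependsOn (s : Finset J)
    (hS : (s : Set J).PairwiseDisjoint S) (hZ : ∀ j ∈ s, DependsOn (Z j) (S j))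
    (hsub : ∀ j ∈ s, HasSubgaussianMGF (Z j) 1 (Measure.pi p)) :
    HasSubgaussianMGF (fun b => ∑ j ∈ s, Z j b) s.card (Measure.pi p) := by
  classical
  induction s using Finset.induction_on with
  | empty => simp
  | insert j s hj ih =>
    have ih' := ih (hS.subset (by simp)) (fun i hi => hZ i (Finset.mem_insert_of_mem hi))
      fun i hi => hsub i (Finset.mem_insert_of_mem hi)
    have hdisj : Disjoint (S j) (s.biUnion S) := by
      rw [Finset.disjoint_biUnion_right]
      intro i hi
      exact hS (by simp) (by simp [hi]) fun h => hj (h ▸ hi)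
    have hdep : DependsOn (fun b => ∑ i ∈ s, Z i b) (s.biUnion S) := fun a b hab => by
      refine Finset.sum_congr rfl fun i hi => hZ i (Finset.mem_insert_of_mem hi) fun e he => ?_
      exact hab e (by simpa using ⟨i, hi, he⟩)
    have hadd := (hsub j (Finset.mem_insert_self j s)).add_of_indepFun ih'
      (indepFun_pi_of_dependsOn p hdisj (hZ j (Finset.mem_insert_self j s)) hdep)
    rw [Finset.card_insert_of_notMem hj, Nat.cast_add, Nat.cast_one, add_comm]
    refine hadd.congr (Filter.Eventually.of_forall fun b => ?_)
    simp [Finset.sum_insert hj]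

/-- Hoeffding's inequality for bounded centred functions of disjoint groups of coordinates. -/
theorem measureReal_abs_sum_pi_ge_le (s : Finset J) {N : ℕ} (hN : s.card ≤ N)
    (hS : (s : Set J).PairwiseDisjoint S) (hZ : ∀ j ∈ s, DependsOn (Z j) (S j))
    (hb : ∀ j ∈ s, ∀ b, |Z j b| ≤ 1) (h0 : ∀ j ∈ s, ∫ b, Z j b ∂(Measure.pi p) = 0)
    {t : ℝ} (ht : 0 ≤ t) :
    (Measure.pi p).real {b | t ≤ |∑ j ∈ s, Z j b|} ≤ 2 * Real.exp (-t ^ 2 / (2 * N)) := by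
  have hsub : ∀ j ∈ s, HasSubgaussianMGF (Z j) 1 (Measure.pi p) := fun j hj => by
    have := hasSubgaussianMGF_of_mem_Icc_of_integral_eq_zero (μ := Measure.pi p) (X := Z j)
      (a := -1) (b := 1) (measurable_of_countable _).aemeasurable
      (Filter.Eventually.of_forall fun b => abs_le.1 (hb j hj b)) (h0 j hj)
    convert this using 1
    ext
    norm_num
  have := hasSubgaussianMGF_mono (hasSubgaussianMGF_sum_pi_of_dependsOn p s hS hZ hsub)
    (by exact_mod_cast hN : (s.card : NNReal) ≤ (N : NNReal))
  simpa using measureReal_abs_ge_le_of_hasSubgaussianMGF this ht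

end ProductOfBool

/-! ### The Bernoulli law -/

section Bernoulli

/-- The Bernoulli law on `Bool` with success probability `p`. -/
noncomputable def boolBernoulli (p : ℝ) : Measure Bool :=
  ENNReal.ofReal p • Measure.dirac true + ENNReal.ofReal (1 - p) • Measure.dirac false

variable {p : ℝ}

theorem isProbabilityMeasure_boolBernoulli (hp : p ∈ Set.Icc (0 : ℝ) 1) :
    IsProbabilityMeasure (boolBernoulli p) := by
  constructor
  simp only [boolBernoulli, Measure.coe_add, Measure.coe_smul, Pi.add_apply, Pi.smul_apply,
    measure_univ, smul_eq_mul, mul_one]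
  rw [← ENNReal.ofReal_add hp.1 (by linarith [hp.2])]
  simp

theorem boolBernoulli_real_singleton (hp : p ∈ Set.Icc (0 : ℝ) 1) (b : Bool) :
    (boolBernoulli p).real {b} = if b = true then p else 1 - p := by
  have h1 := hp.1
  have h2 : 0 ≤ 1 - p := by linarith [hp.2]
  cases b <;> simp [boolBernoulli, measureReal_def, h1, h2]

theorem integral_boolBernoulli_sub (hp : p ∈ Set.Icc (0 : ℝ) 1) :
    ∫ b, ((if b = true then (1 : ℝ) else 0) - p) ∂(boolBernoulli p) = 0 := by
  have := isProbabilityMeasure_boolBernoulli hp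
  rw [integral_fintype .of_finite]
  simp [boolBernoulli_real_singleton hp]
  ring

end Bernoulli

/-! ### Encoding graphs by edge indicators -/

/-- The pairs `i > j` of vertices. -/
abbrev VertexPair (n : ℕ) : Type := (i : Fin n) × Finset.Iio i

/-- The pair formed by two distinct vertices. -/
def vertexPair {n : ℕ} {i j : Fin n} (h : i ≠ j) : VertexPair n :=
  if hji : j < i then ⟨i, j, Finset.mem_Iio.2 hji⟩
  else ⟨j, i, Finset.mem_Iio.2 (lt_of_le_of_ne (not_lt.1 hji) h)⟩

theorem vertexPair_of_gt {n : ℕ} {i j : Fin n} (h : i ≠ j) (hji : j < i) :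
    vertexPair h = ⟨i, j, Finset.mem_Iio.2 hji⟩ :=
  dif_pos hji

theorem vertexPair_of_lt {n : ℕ} {i j : Fin n} (h : i ≠ j) (hij : i < j) :
    vertexPair h = ⟨j, i, Finset.mem_Iio.2 hij⟩ :=
  dif_neg hij.not_gt

theorem vertexPair_comm {n : ℕ} {i j : Fin n} (h : i ≠ j) : vertexPair h = vertexPair h.symm := by
  rcases lt_or_gt_of_ne h with h' | h'
  · rw [vertexPair_of_lt h h', vertexPair_of_gt h.symm h']
  · rw [vertexPair_of_gt h h', vertexPair_of_lt h.symm h']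

/-- Supplies the disjointness of edge sets needed for independence in the Hoeffding sums. -/
theorem vertexPair_mem {n : ℕ} {i j i' j' : Fin n} (h : i ≠ j) (h' : i' ≠ j')
    (he : vertexPair h = vertexPair h') : (i = i' ∧ j = j') ∨ (i = j' ∧ j = i') := by
  have key : ∀ {i j : Fin n} (h : i ≠ j),
      ((vertexPair h).1 = i ∧ ((vertexPair h).2 : Fin n) = j) ∨
        ((vertexPair h).1 = j ∧ ((vertexPair h).2 : Fin n) = i) := fun {i j} h => by
    rcases lt_or_gt_of_ne h with h' | h'
    · rw [vertexPair_of_lt h h']; exact Or.inr ⟨rfl, rfl⟩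
    · rw [vertexPair_of_gt h h']; exact Or.inl ⟨rfl, rfl⟩
  have k1 := key h
  have k2 := key h'
  rw [he] at k1
  grind

/-- The adjacency matrix with prescribed edge indicators. -/
def adjOfPairs {n : ℕ} (b : VertexPair n → Bool) : Matrix (Fin n) (Fin n) ℝ :=
  Matrix.of fun i j => if h : i = j then 0 else if b (vertexPair h) = true then 1 else 0

theorem adjOfPairs_apply_of_ne {n : ℕ} (b : VertexPair n → Bool) {i j : Fin n} (h : i ≠ j) :
    adjOfPairs b i j = if b (vertexPair h) = true then 1 else 0 := by
  simp [adjOfPairs, h]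

theorem adjOfPairs_isAdjMatrix {n : ℕ} (b : VertexPair n → Bool) : (adjOfPairs b).IsAdjMatrix where
  zero_or_one i j := by
    by_cases h : i = j
    · simp [adjOfPairs, h]
    · rw [adjOfPairs_apply_of_ne b h]
      split_ifs <;> simp
  symm := by
    ext i j
    rw [Matrix.transpose_apply]
    by_cases h : i = j
    · simp [h]
    · rw [adjOfPairs_apply_of_ne b h, adjOfPairs_apply_of_ne b (Ne.symm h), vertexPair_comm h]
  apply_diag i := by simp [adjOfPairs]

theorem exists_adjOfPairs_eq {n : ℕ} {a : Matrix (Fin n) (Fin n) ℝ} (ha : a.IsAdjMatrix) :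
    ∃ b, adjOfPairs b = a := by
  classical
  refine ⟨fun e => decide (a e.1 e.2 = 1), ?_⟩
  have key : ∀ i j, (if decide (a i j = 1) = true then (1 : ℝ) else 0) = a i j := fun i j => by
    rcases ha.zero_or_one i j with h | h <;> simp [h]
  ext i j
  by_cases h : i = j
  · simp [adjOfPairs, h, ha.apply_diag]
  · rw [adjOfPairs_apply_of_ne _ h]
    rcases lt_or_gt_of_ne h with h' | h'
    · rw [vertexPair_of_lt h h', ← ha.symm.apply i j]
      exact key j i
    · rw [vertexPair_of_gt h h']
      exact key i j

/-! ### Concentration for fixed latent positions -/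

section EdgeLaw

variable {d n : ℕ}

/-- The conditional law of the edge indicators given the latent positions. -/
noncomputable def edgeLaw (x : Fin n → EuclideanSpace ℝ (Fin d)) : Measure (VertexPair n → Bool) :=
  Measure.pi fun e => boolBernoulli ⟪x e.1, x e.2⟫

variable {x : Fin n → EuclideanSpace ℝ (Fin d)}

theorem edgeLaw_real_singleton (hx : ∀ i j, ⟪x i, x j⟫ ∈ Set.Icc (0 : ℝ) 1)
    (b : VertexPair n → Bool) :
    (edgeLaw x).real {b} = ∏ i, ∏ j ∈ Finset.Iio i,
      if adjOfPairs b i j = 1 then ⟪x i, x j⟫ else 1 - ⟪x i, x j⟫ := by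
  have := fun e : VertexPair n => isProbabilityMeasure_boolBernoulli (hx e.1 e.2)
  rw [edgeLaw, measureReal_def, Measure.pi_singleton, ENNReal.toReal_prod, Fintype.prod_sigma]
  refine Finset.prod_congr rfl fun i _ => ?_
  rw [← Finset.prod_coe_sort (Finset.Iio i)]
  refine Finset.prod_congr rfl fun j _ => ?_
  rw [← measureReal_def, boolBernoulli_real_singleton (hx _ _),
    adjOfPairs_apply_of_ne b (Finset.mem_Iio.1 j.2).ne', vertexPair_of_gt _ (Finset.mem_Iio.1 j.2)]
  split_ifs <;> simp_all

theorem abs_adjOfPairs_sub_inner_le (hx : ∀ i j, ⟪x i, x j⟫ ∈ Set.Icc (0 : ℝ) 1)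
    (b : VertexPair n → Bool) (i j : Fin n) : |adjOfPairs b i j - ⟪x i, x j⟫| ≤ 1 := by
  have h1 := (hx i j).1
  have h2 := (hx i j).2
  rcases (adjOfPairs_isAdjMatrix b).zero_or_one i j with h | h <;> rw [h, abs_le] <;>
    constructor <;> linarith

theorem dependsOn_adjOfPairs_sub {i j : Fin n} (h : i ≠ j) (c : ℝ) :
    DependsOn (fun b => adjOfPairs b i j - c) ({vertexPair h} : Finset (VertexPair n)) := by
  intro a b hab
  simp only [adjOfPairs_apply_of_ne _ h]
  rw [hab (vertexPair h) (by simp)]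

theorem integral_adjOfPairs_sub (hx : ∀ i j, ⟪x i, x j⟫ ∈ Set.Icc (0 : ℝ) 1) {i j : Fin n}
    (h : i ≠ j) : ∫ b, (adjOfPairs b i j - ⟪x i, x j⟫) ∂(edgeLaw x) = 0 := by
  have := fun e : VertexPair n => isProbabilityMeasure_boolBernoulli (hx e.1 e.2)
  have hpair : ⟪x i, x j⟫ = ⟪x (vertexPair h).1, x (vertexPair h).2⟫ := by
    rcases lt_or_gt_of_ne h with h' | h'
    · rw [vertexPair_of_lt h h']
      exact real_inner_comm (x j) (x i)
    · rw [vertexPair_of_gt h h']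
  simp only [adjOfPairs_apply_of_ne _ h]
  rw [hpair, edgeLaw]
  have hmp := measurePreserving_eval
    (fun e : VertexPair n => boolBernoulli ⟪x e.1, x e.2⟫) (vertexPair h)
  have hint := integral_boolBernoulli_sub (hx (vertexPair h).1 (vertexPair h).2)
  rwa [← hmp.map_eq, integral_map (measurable_pi_apply _).aemeasurable
    (measurable_of_countable _).aestronglyMeasurable] at hint

/-- Concentration of a weighted row sum of the centred adjacency matrix. -/
theorem edgeLaw_abs_row_sum_ge_le (hx : ∀ i j, ⟪x i, x j⟫ ∈ Set.Icc (0 : ℝ) 1) {w : Fin n → ℝ}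
    (hw : ∀ j, |w j| ≤ 1) (i : Fin n) {t : ℝ} (ht : 0 ≤ t) :
    (edgeLaw x).real {b | t ≤ |∑ j ∈ Finset.univ.erase i,
      (adjOfPairs b i j - ⟪x i, x j⟫) * w j|} ≤ 2 * Real.exp (-t ^ 2 / (2 * n)) := by
  have := fun e : VertexPair n => isProbabilityMeasure_boolBernoulli (hx e.1 e.2)
  have hne : ∀ j ∈ Finset.univ.erase i, i ≠ j := fun j hj => (Finset.ne_of_mem_erase hj).symm
  -- The j-th term uses the single edge ij. The default ∅ is never reached on the summation range.
  refine measureReal_abs_sum_pi_ge_le _ (N := n)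
    (S := fun j => if h : i = j then ∅ else {vertexPair h}) _
    (by simp) ?_ ?_ ?_ ?_ ht
  · intro j hj k hk hjk
    have h1 := hne j hj
    have h2 := hne k hk
    simp only [Function.onFun, h1, h2, dite_false, Finset.disjoint_singleton]
    intro h
    have := vertexPair_mem h1 h2 h
    grind
  · intro j hj a b hab
    have h1 := hne j hj
    simp only [h1, dite_false] at hab
    exact congrArg (· * w j) (dependsOn_adjOfPairs_sub h1 ⟪x i, x j⟫ hab)
  · intro j _ b
    rw [abs_mul]
    exact mul_le_one₀ (abs_adjOfPairs_sub_inner_le hx b i j) (abs_nonneg _) (hw j)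
  · intro j hj
    rw [integral_mul_const]
    have := integral_adjOfPairs_sub hx (hne j hj)
    rw [edgeLaw] at this
    rw [this, zero_mul]

/-- Concentration of the off-diagonal entries of the square of the centred adjacency matrix. -/
theorem edgeLaw_abs_sum_mul_ge_le (hx : ∀ i j, ⟪x i, x j⟫ ∈ Set.Icc (0 : ℝ) 1) {i k : Fin n}
    (hik : i ≠ k) {t : ℝ} (ht : 0 ≤ t) :
    (edgeLaw x).real {b | t ≤ |∑ j ∈ (Finset.univ.erase i).erase k,
      (adjOfPairs b i j - ⟪x i, x j⟫) * (adjOfPairs b k j - ⟪x k, x j⟫)|} ≤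
      2 * Real.exp (-t ^ 2 / (2 * n)) := by
  have := fun e : VertexPair n => isProbabilityMeasure_boolBernoulli (hx e.1 e.2)
  have hi : ∀ j ∈ (Finset.univ.erase i).erase k, i ≠ j := fun j hj =>
    (Finset.ne_of_mem_erase (Finset.mem_of_mem_erase hj)).symm
  have hk : ∀ j ∈ (Finset.univ.erase i).erase k, k ≠ j := fun j hj =>
    (Finset.ne_of_mem_erase hj).symm
  -- The j-th term uses the edges ij and kj; these pairs of edges are disjoint for different j.
  refine measureReal_abs_sum_pi_ge_le _ (N := n)
    (S := fun j => if h : i = j then ∅ else if h' : k = j then ∅ else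
      {vertexPair h, vertexPair h'}) _
    (by simpa using Finset.card_le_univ ((Finset.univ.erase i).erase k)) ?_ ?_ ?_ ?_ ht
  · intro j hj l hl hjl
    have h1 := hi j hj
    have h2 := hk j hj
    have h3 := hi l hl
    have h4 := hk l hl
    simp only [Function.onFun, h1, h2, h3, h4, dite_false]
    rw [Finset.disjoint_left]
    intro e he he'
    simp only [Finset.mem_insert, Finset.mem_singleton] at he he'
    rcases he with rfl | rfl <;> rcases he' with he' | he' <;>
      have := vertexPair_mem _ _ he' <;> grind
  · intro j hj a b hab
    have h1 := hi j hj
    have h2 := hk j hj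
    simp only [h1, h2, dite_false] at hab
    exact congrArg₂ (· * ·)
      (dependsOn_adjOfPairs_sub h1 ⟪x i, x j⟫ fun e he => hab e (by simp_all))
      (dependsOn_adjOfPairs_sub h2 ⟪x k, x j⟫ fun e he => hab e (by simp_all))
  · intro j _ b
    rw [abs_mul]
    exact mul_le_one₀ (abs_adjOfPairs_sub_inner_le hx b i j) (abs_nonneg _)
      (abs_adjOfPairs_sub_inner_le hx b k j)
  · intro j hj
    -- As i ≠ k, the two edges are distinct, hence independent, and the product of centred
    -- indicators has mean zero.
    have hdisj : Disjoint ({vertexPair (hi j hj)} : Finset (VertexPair n))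
        {vertexPair (hk j hj)} := by
      rw [Finset.disjoint_singleton]
      intro h
      have := vertexPair_mem _ _ h
      grind
    have hind := indepFun_pi_of_dependsOn (fun e : VertexPair n => boolBernoulli ⟪x e.1, x e.2⟫)
      hdisj (dependsOn_adjOfPairs_sub (hi j hj) ⟪x i, x j⟫)
      (dependsOn_adjOfPairs_sub (hk j hj) ⟪x k, x j⟫)
    have h0 := integral_adjOfPairs_sub hx (hi j hj)
    rw [edgeLaw] at h0
    have := hind.integral_mul_eq_mul_integral
      (measurable_of_countable _).aestronglyMeasurable
      (measurable_of_countable _).aestronglyMeasurable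
    rw [h0, zero_mul] at this
    exact this

end EdgeLaw

/-! ### Transfer to the random graph -/

section RandomGraph

variable {d n : ℕ} {Ω : Type*} [MeasurableSpace Ω] {F : Measure (EuclideanSpace ℝ (Fin d))}
  {μ : Measure Ω} {X : Fin n → Ω → EuclideanSpace ℝ (Fin d)}
  {A : Ω → Matrix (Fin n) (Fin n) ℝ}

theorem IsRDPG.ae_inner_mem_Icc (h : IsRDPG F μ X A) (hF : IsLatentDistribution F) :
    ∀ᵐ ω ∂μ, ∀ i j, ⟪X i ω, X j ω⟫ ∈ Set.Icc (0 : ℝ) 1 := by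
  obtain ⟨-, S, hS, hae⟩ := hF
  have hall : ∀ᵐ ω ∂μ, ∀ i, X i ω ∈ S := ae_all_iff.2 fun i => by
    have := hae
    rw [← h.map_position i] at this
    exact ae_of_ae_map (h.measurable_position i).aemeasurable this
  filter_upwards [hall] with ω hω i j using hS _ (hω i) _ (hω j)

theorem IsRDPG.measurableSet_adj_eq (h : IsRDPG F μ X A) (a : Matrix (Fin n) (Fin n) ℝ) :
    MeasurableSet {ω | A ω = a} := by
  have : {ω | A ω = a} = ⋂ i, ⋂ j, (fun ω => A ω i j) ⁻¹' {a i j} := by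
    ext ω
    simp [← Matrix.ext_iff]
  rw [this]
  exact .iInter fun i => .iInter fun j => h.measurable_entry i j (measurableSet_singleton _)

/-- A bound on the conditional probability of an event given the latent positions, in terms of the
product law of the edges, is a bound on its probability. -/
theorem IsRDPG.measureReal_le_of_edgeLaw_le [IsProbabilityMeasure μ]
    (h : IsRDPG F μ X A)
    (hX : ∀ᵐ ω ∂μ, ∀ i j, ⟪X i ω, X j ω⟫ ∈ Set.Icc (0 : ℝ) 1)
    {B : Matrix (Fin n) (Fin n) ℝ → Set (Fin n → EuclideanSpace ℝ (Fin d))}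
    (hB : ∀ a, MeasurableSet (B a)) {δ : ℝ}
    (hδ : ∀ x : Fin n → EuclideanSpace ℝ (Fin d), (∀ i j, ⟪x i, x j⟫ ∈ Set.Icc (0 : ℝ) 1) →
      (edgeLaw x).real {b | x ∈ B (adjOfPairs b)} ≤ δ) :
    μ.real {ω | (fun i => X i ω) ∈ B (A ω)} ≤ δ := by
  classical
  have hmeas : Measurable fun ω i => X i ω := measurable_pi_lambda _ h.measurable_position
  have hm : MeasurableSpace.comap (fun ω i => X i ω) inferInstance ≤ ‹MeasurableSpace Ω› :=
    hmeas.comap_le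
  let w : (VertexPair n → Bool) → Ω → ℝ := fun b ω => ∏ i, ∏ j ∈ Finset.Iio i,
    if adjOfPairs b i j = 1 then ⟪X i ω, X j ω⟫ else 1 - ⟪X i ω, X j ω⟫
  have hcond : ∀ b, μ⟦{ω | A ω = adjOfPairs b} |
      MeasurableSpace.comap (fun ω i => X i ω) inferInstance⟧ =ᵐ[μ] w b := fun b =>
    h.condProb_eq _ (adjOfPairs_isAdjMatrix b)
  let P : (VertexPair n → Bool) → Set Ω := fun b => (fun ω i => X i ω) ⁻¹' B (adjOfPairs b)
  have hP : ∀ b, MeasurableSet (P b) := fun b => hmeas (hB _)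
  have hwint : ∀ b, Integrable (w b) μ := fun b => integrable_condExp.congr (hcond b)
  -- P b is measurable with respect to the positions, so the conditional probability may be
  -- integrated over it. Summing over the finitely many graphs then recovers the mass under
  -- `edgeLaw`.
  have hpiece : ∀ b, μ.real ({ω | A ω = adjOfPairs b} ∩ P b) = ∫ ω, (P b).indicator (w b) ω ∂μ := by
    intro b
    have hAb := h.measurableSet_adj_eq (adjOfPairs b)
    have h1 := setIntegral_condExp (μ := μ) hm (s := P b)
      (f := {ω | A ω = adjOfPairs b}.indicator fun _ => (1 : ℝ))
      ((integrable_const 1).indicator hAb) ⟨_, hB _, rfl⟩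
    rw [integral_indicator (hP b), ← setIntegral_congr_ae (g := w b) (hP b)
      ((hcond b).mono fun ω hω _ => hω), h1, setIntegral_indicator hAb, setIntegral_const]
    simp [Set.inter_comm]
  have hsub : {ω | (fun i => X i ω) ∈ B (A ω)} ⊆
      ⋃ b ∈ (Finset.univ : Finset (VertexPair n → Bool)), {ω | A ω = adjOfPairs b} ∩ P b := by
    intro ω hω
    obtain ⟨b, hb⟩ := exists_adjOfPairs_eq (h.isAdjMatrix ω)
    refine Set.mem_biUnion (Finset.mem_univ b) ⟨hb.symm, ?_⟩
    change (fun i => X i ω) ∈ B (adjOfPairs b)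
    rw [hb]
    exact hω
  calc μ.real {ω | (fun i => X i ω) ∈ B (A ω)}
      ≤ ∑ b, μ.real ({ω | A ω = adjOfPairs b} ∩ P b) :=
        (measureReal_mono hsub (measure_ne_top μ _)).trans (measureReal_biUnion_finset_le _ _)
    _ = ∫ ω, ∑ b, (P b).indicator (w b) ω ∂μ := by
        rw [integral_finsetSum _ fun b _ => (hwint b).indicator (hP b)]
        exact Finset.sum_congr rfl fun b _ => hpiece b
    _ ≤ ∫ _, δ ∂μ := by
        refine integral_mono_ae (integrable_finsetSum _ fun b _ => (hwint b).indicator (hP b))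
          (integrable_const δ) ?_
        filter_upwards [hX] with ω hω
        have := fun e : VertexPair n => isProbabilityMeasure_boolBernoulli (hω e.1 e.2)
        have : IsProbabilityMeasure (edgeLaw fun i => X i ω) := by
          unfold edgeLaw; infer_instance
        refine le_trans (le_of_eq ?_) (hδ (fun i => X i ω) hω)
        have hset : {b | (fun i => X i ω) ∈ B (adjOfPairs b)} =
            ((Finset.univ.filter fun b => (fun i => X i ω) ∈ B (adjOfPairs b) :
              Finset (VertexPair n → Bool)) : Set (VertexPair n → Bool)) := by
          ext b; simp
        rw [hset, ← sum_measureReal_singleton, Finset.sum_filter]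
        refine Finset.sum_congr rfl fun b _ => ?_
        rw [edgeLaw_real_singleton hω b, Set.indicator_apply]
        rfl
    _ = δ := by simp

theorem abs_apply_le_one_of_inner_le {x : EuclideanSpace ℝ (Fin d)} (hx : ⟪x, x⟫ ≤ 1)
    (k : Fin d) : |x k| ≤ 1 := by
  have h1 : ‖x‖ ≤ 1 := by
    rw [real_inner_self_eq_norm_sq] at hx
    exact (sq_le_one_iff₀ (norm_nonneg x)).1 hx
  exact (PiLp.norm_apply_le x k).trans h1

theorem IsRDPG.measureReal_abs_row_sum_ge_le [IsProbabilityMeasure μ]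
    (h : IsRDPG F μ X A) (hF : IsLatentDistribution F)
    (i : Fin n) (k : Fin d) {t : ℝ} (ht : 0 ≤ t) :
    μ.real {ω | t ≤ |∑ j ∈ Finset.univ.erase i, (A ω i j - ⟪X i ω, X j ω⟫) * X j ω k|} ≤
      2 * Real.exp (-t ^ 2 / (2 * n)) := by
  refine h.measureReal_le_of_edgeLaw_le (h.ae_inner_mem_Icc hF)
    (B := fun a => {x | t ≤ |∑ j ∈ Finset.univ.erase i, (a i j - ⟪x i, x j⟫) * x j k|})
    (fun a => ?_) fun x hx => ?_
  · refine measurableSet_le measurable_const ?_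
    fun_prop
  · exact edgeLaw_abs_row_sum_ge_le hx
      (fun j => abs_apply_le_one_of_inner_le (hx j j).2 k) i ht

theorem IsRDPG.measureReal_abs_sum_mul_ge_le [IsProbabilityMeasure μ]
    (h : IsRDPG F μ X A) (hF : IsLatentDistribution F)
    {i k : Fin n} (hik : i ≠ k) {t : ℝ} (ht : 0 ≤ t) :
    μ.real {ω | t ≤ |∑ j ∈ (Finset.univ.erase i).erase k,
      (A ω i j - ⟪X i ω, X j ω⟫) * (A ω k j - ⟪X k ω, X j ω⟫)|} ≤
      2 * Real.exp (-t ^ 2 / (2 * n)) := by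
  refine h.measureReal_le_of_edgeLaw_le (h.ae_inner_mem_Icc hF)
    (B := fun a => {x | t ≤ |∑ j ∈ (Finset.univ.erase i).erase k,
      (a i j - ⟪x i, x j⟫) * (a k j - ⟪x k, x j⟫)|})
    (fun a => ?_) fun x hx => ?_
  · refine measurableSet_le measurable_const ?_
    fun_prop
  · exact edgeLaw_abs_sum_mul_ge_le hx hik ht

/-- No conditioning is needed: these are i.i.d. sums of products of coordinates lying in [−1, 1]. -/
theorem IsRDPG.measureReal_abs_gram_sub_ge_le [IsProbabilityMeasure μ]
    (h : IsRDPG F μ X A) (hF : IsLatentDistribution F)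
    (k l : Fin d) {t : ℝ} (ht : 0 ≤ t) :
    μ.real {ω | t ≤ |∑ i, (X i ω k * X i ω l - secondMoment F k l)|} ≤
      2 * Real.exp (-t ^ 2 / (2 * n)) := by
  have hmeas : Measurable fun x : EuclideanSpace ℝ (Fin d) => x k * x l - secondMoment F k l := by
    fun_prop
  have hind : iIndepFun (fun i ω => X i ω k * X i ω l - secondMoment F k l) μ :=
    h.indep.comp (fun _ x => x k * x l - secondMoment F k l) fun _ => hmeas
  have hsub : ∀ i ∈ (Finset.univ : Finset (Fin n)),
      HasSubgaussianMGF (fun ω => X i ω k * X i ω l - secondMoment F k l) 1 μ := fun i _ => by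
    have hm : Measurable fun ω => X i ω k * X i ω l := by
      have := h.measurable_position i
      fun_prop
    have hmean : μ[fun ω => X i ω k * X i ω l] = secondMoment F k l := by
      have hm' : Measurable fun x : EuclideanSpace ℝ (Fin d) => x k * x l := by fun_prop
      rw [secondMoment, Matrix.of_apply, ← h.map_position i,
        integral_map (h.measurable_position i).aemeasurable hm'.aestronglyMeasurable]
    have := hasSubgaussianMGF_of_mem_Icc (μ := μ) (a := -1) (b := 1) hm.aemeasurable
      (by
        filter_upwards [h.ae_inner_mem_Icc hF] with ω hω
        rw [Set.mem_Icc, ← abs_le, abs_mul]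
        exact mul_le_one₀ (abs_apply_le_one_of_inner_le (hω i i).2 k) (abs_nonneg _)
          (abs_apply_le_one_of_inner_le (hω i i).2 l))
    rw [hmean] at this
    convert this using 1
    ext
    norm_num
  simpa using measureReal_abs_ge_le_of_hasSubgaussianMGF
    (HasSubgaussianMGF.sum_of_iIndepFun hind hsub) ht

end RandomGraph

/-! ### The second moment matrix -/

section SecondMoment

variable {d : ℕ} {F : Measure (EuclideanSpace ℝ (Fin d))}

theorem IsLatentDistribution.integrable_mul (hF : IsLatentDistribution F) (k l : Fin d) :
    Integrable (fun x : EuclideanSpace ℝ (Fin d) => x k * x l) F := by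
  obtain ⟨hprob, S, hS, hae⟩ := hF
  refine Integrable.of_bound (by fun_prop) 1 ?_
  filter_upwards [hae] with x hx
  rw [Real.norm_eq_abs, abs_mul]
  exact mul_le_one₀ (abs_apply_le_one_of_inner_le (hS x hx x hx).2 k) (abs_nonneg _)
    (abs_apply_le_one_of_inner_le (hS x hx x hx).2 l)

/-- The quadratic form at z is the expectation of ⟨z, X₁⟩². -/
theorem IsLatentDistribution.posSemidef_secondMoment (hF : IsLatentDistribution F) :
    (secondMoment F).PosSemidef := by
  refine .of_dotProduct_mulVec_nonneg ?_ fun z => ?_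
  · ext k l
    simp [secondMoment, mul_comm]
  · have h : star z ⬝ᵥ (secondMoment F *ᵥ z) =
        ∫ x : EuclideanSpace ℝ (Fin d), (∑ k, z k * x k) ^ 2 ∂F := by
      have h1 : ∀ x : EuclideanSpace ℝ (Fin d), (∑ k, z k * x k) ^ 2 =
          ∑ k, ∑ l, z k * z l * (x k * x l) := fun x => by
        rw [sq, Finset.sum_mul_sum]
        exact Finset.sum_congr rfl fun k _ => Finset.sum_congr rfl fun l _ => by ring
      simp only [h1]
      rw [integral_finsetSum _ fun k _ => integrable_finsetSum _ fun l _ =>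
        (hF.integrable_mul k l).const_mul _]
      simp only [dotProduct, Matrix.mulVec, Finset.mul_sum]
      refine Finset.sum_congr rfl fun k _ => ?_
      rw [integral_finsetSum _ fun l _ => (hF.integrable_mul k l).const_mul _]
      refine Finset.sum_congr rfl fun l _ => ?_
      rw [integral_const_mul, secondMoment, Matrix.of_apply]
      simp only [star_trivial]
      ring
    rw [h]
    exact integral_nonneg fun x => sq_nonneg _

end SecondMoment

/-! ### Embedding error from scalar deviations -/

section Deterministic

open scoped Matrix.Norms.Frobenius

theorem Matrix.PosSemidef.exists_pos_mul_norm_sq_le {m : Type*} [Fintype m] [DecidableEq m]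
    {H : Matrix m m ℝ} (hH : H.PosSemidef) (hrank : H.rank = Fintype.card m) :
    ∃ δ : ℝ, 0 < δ ∧ ∀ z : Matrix m Unit ℝ, δ * ‖z‖ ^ 2 ≤ (zᵀ * (H * z)).trace := by
  have hunit : IsUnit H := by
    rw [← Matrix.mulVec_surjective_iff_isUnit]
    have : LinearMap.range H.mulVecLin = ⊤ :=
      Submodule.eq_top_of_finrank_eq (by rw [Module.finrank_fintype_fun_eq_card, ← hrank]; rfl)
    exact LinearMap.range_eq_top.1 this
  obtain ⟨R, hR, rfl⟩ := hH.exists_sq_eq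
  have hRt : Rᵀ = R := by simpa [Matrix.IsSymm] using hR.1
  have hRu : IsUnit R.det := by
    rw [Matrix.isUnit_iff_isUnit_det, Matrix.det_mul] at hunit
    exact isUnit_of_mul_isUnit_left hunit
  -- From ‖z‖ ≤ ‖R⁻¹‖‖Rz‖ with R the square root of the matrix; the added 1 keeps the constant
  -- positive even in dimension zero.
  refine ⟨(‖R⁻¹‖ ^ 2 + 1)⁻¹, by positivity, fun z => ?_⟩
  have h1 : zᵀ * (R * R * z) = (R * z)ᵀ * (R * z) := by
    rw [Matrix.transpose_mul, hRt]; simp only [Matrix.mul_assoc]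
  have h2 : ‖z‖ ≤ ‖R⁻¹‖ * ‖R * z‖ := by
    calc ‖z‖ = ‖R⁻¹ * (R * z)‖ := by
          rw [← Matrix.mul_assoc, Matrix.nonsing_inv_mul _ hRu, Matrix.one_mul]
      _ ≤ _ := Matrix.frobenius_norm_mul _ _
  rw [h1, ← frobenius_norm_sq_eq_trace, inv_mul_le_iff₀ (by positivity)]
  have h3 := pow_le_pow_left₀ (norm_nonneg z) h2 2
  nlinarith [sq_nonneg ‖R * z‖]

theorem frobenius_norm_le_of_entry_le {m n : Type*} [Fintype m] [Fintype n] (B : Matrix m n ℝ)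
    {c : ℝ} (hc : 0 ≤ c) (h : ∀ i j, |B i j| ≤ c) :
    ‖B‖ ≤ √(Fintype.card m) * (√(Fintype.card n) * c) :=
  frobenius_norm_le_of_row_le B (by positivity) fun i => norm_row_le_of_entry_le B hc i (h i)

/-- Write XᵀX = nH + B. The entries of B are at most h, so its Frobenius norm is at most dh. -/
theorem gram_lower_bound {d n : ℕ} {X : Matrix (Fin n) (Fin d) ℝ} {H : Matrix (Fin d) (Fin d) ℝ}
    {δ h : ℝ} (hH : ∀ z : Matrix (Fin d) Unit ℝ, δ * ‖z‖ ^ 2 ≤ (zᵀ * (H * z)).trace) (hh : 0 ≤ h)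
    (hX : ∀ k l, |∑ i, (X i k * X i l - H k l)| ≤ h) (z : Matrix (Fin d) Unit ℝ) :
    (n * δ - d * h) * ‖z‖ ^ 2 ≤ ‖X * z‖ ^ 2 := by
  set B := Xᵀ * X - (n : ℝ) • H with hB
  have hBn : ‖B‖ ≤ d * h := by
    have := frobenius_norm_le_of_entry_le B hh fun k l => by
      convert hX k l using 2
      simp [hB, Matrix.mul_apply, Finset.sum_sub_distrib]
    rwa [← mul_assoc, Fintype.card_fin, Real.mul_self_sqrt (by positivity)] at this
  have h1 : (X * z)ᵀ * (X * z) = (n : ℝ) • (zᵀ * (H * z)) + zᵀ * (B * z) := by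
    rw [hB, Matrix.transpose_mul, Matrix.sub_mul, Matrix.mul_sub, Matrix.smul_mul,
      Matrix.mul_smul]
    simp only [Matrix.mul_assoc]
    abel
  have h2 : ‖z‖ * ‖B * z‖ ≤ d * h * ‖z‖ ^ 2 := by
    calc ‖z‖ * ‖B * z‖ ≤ ‖z‖ * (‖B‖ * ‖z‖) := by gcongr; exact Matrix.frobenius_norm_mul _ _
      _ ≤ ‖z‖ * (d * h * ‖z‖) := by gcongr
      _ = _ := by ring
  have h3 := neg_le_of_abs_le (abs_trace_transpose_mul_le z (B * z))
  have h4 := mul_le_mul_of_nonneg_left (hH z) (Nat.cast_nonneg (α := ℝ) n)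
  rw [frobenius_norm_sq_eq_trace (X * z), h1, Matrix.trace_add, Matrix.trace_smul, smul_eq_mul]
  nlinarith

theorem frobenius_norm_sq_le_of_diag_offDiag {n : ℕ} (B : Matrix (Fin n) (Fin n) ℝ) {t : ℝ}
    (hdiag : ∀ i, |B i i| ≤ n) (hoff : ∀ i k, i ≠ k → |B i k| ≤ t) :
    ‖B‖ ^ 2 ≤ (n : ℝ) ^ 2 * (n + t ^ 2) := by
  have hrow : ∀ i, ∑ k, B i k ^ 2 ≤ (n : ℝ) ^ 2 + n * t ^ 2 := fun i => by
    rw [← Finset.add_sum_erase _ _ (Finset.mem_univ i)]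
    refine add_le_add (sq_le_sq.2 (by simpa using hdiag i)) ?_
    calc ∑ k ∈ Finset.univ.erase i, B i k ^ 2 ≤ ∑ k ∈ Finset.univ.erase i, t ^ 2 := by
          refine Finset.sum_le_sum fun k hk => ?_
          exact sq_le_sq.2 ((hoff i k (Finset.ne_of_mem_erase hk).symm).trans (le_abs_self t))
      _ ≤ ∑ _k : Fin n, t ^ 2 :=
          Finset.sum_le_sum_of_subset_of_nonneg (Finset.erase_subset _ _) fun _ _ _ => sq_nonneg t
      _ = n * t ^ 2 := by simp
  rw [frobenius_norm_sq_eq_sum]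
  calc ∑ i, ∑ k, B i k ^ 2 ≤ ∑ _i : Fin n, ((n : ℝ) ^ 2 + n * t ^ 2) :=
        Finset.sum_le_sum fun i _ => hrow i
    _ = _ := by simp; ring

/-- The embedding error of a graph whose row sums, codegrees and empirical second moments are all
close to their expectations. -/
theorem IsASE.twoToInftyNorm_le_of_concentration {d n : ℕ} (hn : 0 < n)
    {x : Fin n → EuclideanSpace ℝ (Fin d)} (hx : ∀ i j, ⟪x i, x j⟫ ∈ Set.Icc (0 : ℝ) 1)
    {a : Matrix (Fin n) (Fin n) ℝ} (ha : a.IsAdjMatrix) {H : Matrix (Fin d) (Fin d) ℝ} {κ t : ℝ}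
    (hκ : 0 < κ) (ht : 0 ≤ t)
    (hH : ∀ z : Matrix (Fin d) Unit ℝ, 4 * κ * ‖z‖ ^ 2 ≤ (zᵀ * (H * z)).trace)
    (hrow : ∀ i k, |∑ j ∈ Finset.univ.erase i, (a i j - ⟪x i, x j⟫) * x j k| ≤ t)
    (hcodeg : ∀ i k, i ≠ k → |∑ j ∈ (Finset.univ.erase i).erase k,
      (a i j - ⟪x i, x j⟫) * (a k j - ⟪x k, x j⟫)| ≤ t)
    (hgram : ∀ k l, |∑ i, (x i k * x i l - H k l)| ≤ n * (4 * κ) / (2 * d + 1))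
    (hsize : n + (t + 2) ^ 2 ≤ κ ^ 4 * n ^ 2 / 16)
    {ρ : ℝ} (hρ : ρ = √d / √κ) (hsmall : √d * (t + 2) / n * (2 * ρ ^ 2 / κ) < 1)
    {Xhat : Matrix (Fin n) (Fin d) ℝ} (hXhat : IsASE d a Xhat) :
    ∃ W ∈ Matrix.orthogonalGroup (Fin d) ℝ,
      twoToInftyNorm (Xhat - Matrix.of (fun i k => x i k) * W) ≤
        √d * (t + 2) / n * (ρ / κ + 2 * ρ / κ ^ 2 + 2 * ρ ^ 2 / κ) := by
  have hN : (0 : ℝ) < n := by exact_mod_cast hn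
  set X : Matrix (Fin n) (Fin d) ℝ := Matrix.of fun i k => x i k with hX
  set E := a - X * Xᵀ with hEdef
  have hE : ∀ i j, E i j = a i j - ⟪x i, x j⟫ := fun i j => by
    simp [hEdef, hX, Matrix.mul_apply, PiLp.inner_apply, mul_comm]
  have hEle : ∀ i j, |E i j| ≤ 1 := fun i j => by
    have h1 := (hx i j).1
    have h2 := (hx i j).2
    rw [hE]
    rcases ha.zero_or_one i j with h | h <;> rw [h, abs_le] <;> constructor <;> linarith
  have hEt : ∀ i j, E i j = E j i := fun i j => by
    rw [hE, hE, ha.symm.apply, real_inner_comm]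
  -- The diagonal of E is not centred, so it is split off. It costs 1 here and 2 in the entries of
  -- E²; t + 2 serves both.
  have hEX : ∀ i k, |(E * X) i k| ≤ t + 2 := fun i k => by
    rw [Matrix.mul_apply, ← Finset.add_sum_erase _ _ (Finset.mem_univ i)]
    have h1 : |E i i * X i k| ≤ 1 := by
      rw [abs_mul]
      exact mul_le_one₀ (hEle i i) (abs_nonneg _) (abs_apply_le_one_of_inner_le (hx i i).2 k)
    have h2 : |∑ j ∈ Finset.univ.erase i, E i j * X j k| ≤ t := by
      simpa only [hE, hX, Matrix.of_apply] using hrow i k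
    exact (abs_add_le _ _).trans (by linarith)
  -- Here ε = κn/2, the largest value that the absorption step permits.
  have hEE : ‖E * E‖ ≤ (κ * n / 2) ^ 2 := by
    refine le_of_sq_le_sq ?_ (by positivity)
    refine (frobenius_norm_sq_le_of_diag_offDiag (t := t + 2) _ (fun i => ?_)
      fun i k hik => ?_).trans ?_
    · rw [Matrix.mul_apply]
      refine (Finset.abs_sum_le_sum_abs _ _).trans ?_
      calc ∑ j, |E i j * E j i| ≤ ∑ _j : Fin n, (1 : ℝ) := by
            refine Finset.sum_le_sum fun j _ => ?_
            rw [abs_mul]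
            exact mul_le_one₀ (hEle _ _) (abs_nonneg _) (hEle _ _)
        _ = n := by simp
    · rw [Matrix.mul_apply, ← Finset.add_sum_erase _ _ (Finset.mem_univ i),
        ← Finset.add_sum_erase _ _ (Finset.mem_erase.2 ⟨hik.symm, Finset.mem_univ k⟩)]
      have h1 : ∀ j, |E i j * E j k| ≤ 1 := fun j => by
        rw [abs_mul]
        exact mul_le_one₀ (hEle _ _) (abs_nonneg _) (hEle _ _)
      have h2 : |∑ j ∈ (Finset.univ.erase i).erase k, E i j * E j k| ≤ t := by
        simp only [fun j => hEt j k]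
        simpa only [hE] using hcodeg i k hik
      have h3 := abs_add_le (E i k * E k k) (∑ j ∈ (Finset.univ.erase i).erase k, E i j * E j k)
      refine (abs_add_le _ _).trans ?_
      linarith [h1 i, h1 k]
    · calc (n : ℝ) ^ 2 * (n + (t + 2) ^ 2) ≤ n ^ 2 * (κ ^ 4 * n ^ 2 / 16) := by gcongr
        _ = _ := by ring
  refine hXhat.exists_orthogonal_twoToInftyNorm_le hn ha.symm hκ (by positivity : 0 ≤ κ * n / 2)
    (by positivity) (by linarith) hEE (fun i => ?_) (fun z => ?_) hEX hEle hρ hsmall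
  · have : ‖x i‖ ≤ 1 := by
      have := (hx i i).2
      rw [real_inner_self_eq_norm_sq] at this
      exact (sq_le_one_iff₀ (norm_nonneg _)).1 this
    exact this
  · refine le_trans ?_ (gram_lower_bound hH (by positivity) hgram z)
    gcongr
    -- The fluctuation of the Gram matrix uses at most half of the lower bound 4κn.
    have : d * (n * (4 * κ) / (2 * d + 1)) ≤ 2 * κ * n := by
      rw [mul_div_assoc', div_le_iff₀ (by positivity)]
      nlinarith [mul_pos hκ hN]
    linarith

end Deterministic

/-! ### Union bound over the deviations -/

/-- The probability that some row sum, codegree or empirical second moment of a random dot product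
graph deviates substantially from its expectation. -/
theorem IsRDPG.measureReal_deviation_le {d n : ℕ} {Ω : Type*} [MeasurableSpace Ω]
    {F : Measure (EuclideanSpace ℝ (Fin d))} {μ : Measure Ω} [IsProbabilityMeasure μ]
    {X : Fin n → Ω → EuclideanSpace ℝ (Fin d)} {A : Ω → Matrix (Fin n) (Fin n) ℝ}
    (h : IsRDPG F μ X A) (hF : IsLatentDistribution F) {t u : ℝ} (ht : 0 ≤ t) (hu : 0 ≤ u) :
    μ.real {ω | ¬((∀ i j, ⟪X i ω, X j ω⟫ ∈ Set.Icc (0 : ℝ) 1) ∧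
      (∀ i k, |∑ j ∈ Finset.univ.erase i, (A ω i j - ⟪X i ω, X j ω⟫) * X j ω k| ≤ t) ∧
      (∀ i k, i ≠ k → |∑ j ∈ (Finset.univ.erase i).erase k,
        (A ω i j - ⟪X i ω, X j ω⟫) * (A ω k j - ⟪X k ω, X j ω⟫)| ≤ t) ∧
      ∀ k l, |∑ i, (X i ω k * X i ω l - secondMoment F k l)| ≤ u)} ≤
    (n * d + n ^ 2) * (2 * Real.exp (-t ^ 2 / (2 * n))) +
      d ^ 2 * (2 * Real.exp (-u ^ 2 / (2 * n))) := by
  set N : Set Ω := {ω | ¬ ∀ i j, ⟪X i ω, X j ω⟫ ∈ Set.Icc (0 : ℝ) 1} with hN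
  set R : Fin n × Fin d → Set Ω := fun p =>
    {ω | t ≤ |∑ j ∈ Finset.univ.erase p.1, (A ω p.1 j - ⟪X p.1 ω, X j ω⟫) * X j ω p.2|} with hR
  set C : Fin n × Fin n → Set Ω := fun p => {ω | p.1 ≠ p.2 ∧
    t ≤ |∑ j ∈ (Finset.univ.erase p.1).erase p.2,
      (A ω p.1 j - ⟪X p.1 ω, X j ω⟫) * (A ω p.2 j - ⟪X p.2 ω, X j ω⟫)|} with hC
  set G : Fin d × Fin d → Set Ω := fun p =>
    {ω | u ≤ |∑ i, (X i ω p.1 * X i ω p.2 - secondMoment F p.1 p.2)|} with hG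
  have hN0 : μ.real N = 0 := by
    rw [measureReal_def, ae_iff.1 (h.ae_inner_mem_Icc hF), ENNReal.toReal_zero]
  have hRle : μ.real (⋃ p, R p) ≤ n * d * (2 * Real.exp (-t ^ 2 / (2 * n))) := by
    calc μ.real (⋃ p, R p) ≤ ∑ p, μ.real (R p) := measureReal_iUnion_fintype_le _
      _ ≤ ∑ _p : Fin n × Fin d, 2 * Real.exp (-t ^ 2 / (2 * n)) :=
        Finset.sum_le_sum fun p _ => h.measureReal_abs_row_sum_ge_le hF p.1 p.2 ht
      _ = _ := by simp
  have hCle : μ.real (⋃ p, C p) ≤ n ^ 2 * (2 * Real.exp (-t ^ 2 / (2 * n))) := by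
    calc μ.real (⋃ p, C p) ≤ ∑ p, μ.real (C p) := measureReal_iUnion_fintype_le _
      _ ≤ ∑ _p : Fin n × Fin n, 2 * Real.exp (-t ^ 2 / (2 * n)) := by
        refine Finset.sum_le_sum fun p _ => ?_
        by_cases hp : p.1 = p.2
        · simp only [hC, hp, ne_eq, not_true_eq_false, false_and, Set.ofPred_false,
            measureReal_empty]
          positivity
        · simpa [hC, hp] using h.measureReal_abs_sum_mul_ge_le hF hp ht
      _ = _ := by simp [sq]
  have hGle : μ.real (⋃ p, G p) ≤ d ^ 2 * (2 * Real.exp (-u ^ 2 / (2 * n))) := by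
    calc μ.real (⋃ p, G p) ≤ ∑ p, μ.real (G p) := measureReal_iUnion_fintype_le _
      _ ≤ ∑ _p : Fin d × Fin d, 2 * Real.exp (-u ^ 2 / (2 * n)) :=
        Finset.sum_le_sum fun p _ => h.measureReal_abs_gram_sub_ge_le hF p.1 p.2 hu
      _ = _ := by simp [sq]
  have hsub : {ω | ¬((∀ i j, ⟪X i ω, X j ω⟫ ∈ Set.Icc (0 : ℝ) 1) ∧
      (∀ i k, |∑ j ∈ Finset.univ.erase i, (A ω i j - ⟪X i ω, X j ω⟫) * X j ω k| ≤ t) ∧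
      (∀ i k, i ≠ k → |∑ j ∈ (Finset.univ.erase i).erase k,
        (A ω i j - ⟪X i ω, X j ω⟫) * (A ω k j - ⟪X k ω, X j ω⟫)| ≤ t) ∧
      ∀ k l, |∑ i, (X i ω k * X i ω l - secondMoment F k l)| ≤ u)} ⊆
      N ∪ ((⋃ p, R p) ∪ ((⋃ p, C p) ∪ ⋃ p, G p)) := by
    intro ω hω
    by_contra hcon
    simp only [Set.mem_union, Set.mem_iUnion, not_or, not_exists] at hcon
    obtain ⟨h1, h2, h3, h4⟩ := hcon
    refine hω ⟨not_not.1 h1, fun i k => ?_, fun i k hik => ?_, fun k l => ?_⟩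
    · exact (not_le.1 (h2 (i, k))).le
    · exact (not_le.1 fun hle => h3 (i, k) ⟨hik, hle⟩).le
    · exact (not_le.1 (h4 (k, l))).le
  have h1 := measureReal_mono (μ := μ) hsub
  have h2 := measureReal_union_le (μ := μ) N ((⋃ p, R p) ∪ ((⋃ p, C p) ∪ ⋃ p, G p))
  have h3 := measureReal_union_le (μ := μ) (⋃ p, R p) ((⋃ p, C p) ∪ ⋃ p, G p)
  have h4 := measureReal_union_le (μ := μ) (⋃ p, C p) (⋃ p, G p)
  linarith

/-! ### Asymptotic estimates -/

section Asymptotics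

open Filter

theorem eventually_mul_log_pow_le (K : ℝ) {γ : ℝ} (hγ : 0 < γ) (m : ℕ) :
    ∀ᶠ n : ℕ in atTop, K * Real.log n ^ m ≤ γ * n := by
  have h := (Real.isLittleO_pow_log_id_atTop (n := m)).comp_tendsto tendsto_natCast_atTop_atTop
  have hK : 0 < γ / (|K| + 1) := by positivity
  filter_upwards [h.def hK] with n hn
  simp only [Function.comp_apply, Real.norm_eq_abs, id, Nat.abs_cast] at hn
  rw [div_mul_eq_mul_div, le_div_iff₀ (by positivity)] at hn
  calc K * Real.log n ^ m ≤ |K * Real.log n ^ m| := le_abs_self _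
    _ = |K| * |Real.log n ^ m| := abs_mul _ _
    _ ≤ γ * n := by nlinarith [abs_nonneg (Real.log n ^ m)]

theorem eventually_le_log (K : ℝ) : ∀ᶠ n : ℕ in atTop, K ≤ Real.log n :=
  (Real.tendsto_log_atTop.comp tendsto_natCast_atTop_atTop).eventually_ge_atTop K

/-- Each exponential is at most n^{-(c+3)}, and the polynomial number of events costs at most n³.
For t this works for every c because log²n/2 eventually exceeds (c + 3) log n. -/
theorem tail_sum_le_rpow_neg {d n : ℕ} (hn : 0 < n) {c t u : ℝ} (ht : t = √n * Real.log n)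
    (hlog : 2 * (c + 3) ≤ Real.log n) (hlog0 : 0 ≤ Real.log n)
    (hu : (c + 3) * Real.log n ≤ u ^ 2 / (2 * n))
    (hd : 2 * d + 2 + 2 * d ^ 2 ≤ n) :
    (n * d + n ^ 2) * (2 * Real.exp (-t ^ 2 / (2 * n))) +
      d ^ 2 * (2 * Real.exp (-u ^ 2 / (2 * n))) ≤ (n : ℝ) ^ (-c) := by
  have hN : (0 : ℝ) < n := by exact_mod_cast hn
  have h1N : (1 : ℝ) ≤ n := by exact_mod_cast hn
  set e : ℝ := Real.exp (-((c + 3) * Real.log n)) with he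
  have het : Real.exp (-t ^ 2 / (2 * n)) ≤ e := by
    rw [he, Real.exp_le_exp, ht, mul_pow, Real.sq_sqrt hN.le]
    have : -(n * Real.log n ^ 2) / (2 * n) = -(Real.log n ^ 2 / 2) := by field_simp
    rw [this]
    nlinarith
  have heu : Real.exp (-u ^ 2 / (2 * n)) ≤ e := by
    rw [he, Real.exp_le_exp, neg_div]
    exact neg_le_neg hu
  have hec : (n : ℝ) ^ 3 * e = (n : ℝ) ^ (-c) := by
    have h1 : (n : ℝ) ^ 3 = Real.exp (3 * Real.log n) := by
      rw [mul_comm, Real.exp_mul, Real.exp_log hN]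
      norm_cast
    rw [he, Real.rpow_def_of_pos hN, h1, ← Real.exp_add]
    ring_nf
  have hd' : (2 * d + 2 + 2 * d ^ 2 : ℝ) ≤ n := by exact_mod_cast hd
  calc _ ≤ (n * d + n ^ 2) * (2 * e) + d ^ 2 * (2 * e) := by gcongr
    _ = (2 * (n * d) + 2 * n ^ 2 + 2 * d ^ 2) * e := by ring
    _ ≤ (n : ℝ) ^ 3 * e := by
      refine mul_le_mul_of_nonneg_right ?_ (Real.exp_pos _).le
      have hd0 : (0 : ℝ) ≤ d := Nat.cast_nonneg d
      have h2 : (n : ℝ) ≤ n ^ 2 := by nlinarith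
      have h3 : (n : ℝ) ^ 2 * (2 * d + 2 + 2 * d ^ 2) ≤ n ^ 2 * n := by gcongr
      have h4 : (n : ℝ) * d ≤ n ^ 2 * d := by gcongr
      have h5 : 1 * (d : ℝ) ^ 2 ≤ n ^ 2 * d ^ 2 := by gcongr; linarith
      nlinarith
    _ = _ := hec

end Asymptotics

/-! ### Assembly -/

theorem theorem1 :
    ∃ C : ℝ, 0 < C ∧
      ∀ (d : ℕ) (F : Measure (EuclideanSpace ℝ (Fin d))), IsLatentDistribution F →
        (secondMoment F).rank = d →
      ∀ (Ω : ℕ → Type*) [∀ n, MeasurableSpace (Ω n)] (μ : ∀ n, Measure (Ω n))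
        [∀ n, IsProbabilityMeasure (μ n)]
        (X : ∀ n, Fin n → Ω n → EuclideanSpace ℝ (Fin d))
        (A : ∀ n, Ω n → Matrix (Fin n) (Fin n) ℝ),
        (∀ n, IsRDPG F (μ n) (X n) (A n)) →
        OccursAAS μ fun n =>
          {ω | ∀ Xhat : Matrix (Fin n) (Fin d) ℝ, IsASE d (A n ω) Xhat →
            ∃ W ∈ Matrix.orthogonalGroup (Fin d) ℝ,
              twoToInftyNorm (Xhat - positionMatrix (X n) ω * W) ≤
                C * √(d : ℝ) * Real.log n ^ 2 / √(n : ℝ)} := by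
  -- C = 1 suffices: the error is at most 2K√d log n/√n, and 2K ≤ log n eventually.
  refine ⟨1, one_pos, ?_⟩
  intro d F hF hrank Ω _ μ _ X A hRDPG c hc
  obtain ⟨δ, hδ, hH⟩ := hF.posSemidef_secondMoment.exists_pos_mul_norm_sq_le (by simpa using hrank)
  -- The Gram fluctuation reduces 4κn to 2κn, and subtracting ε = κn/2 still leaves the leading
  -- eigenvalues above κn.
  obtain ⟨κ, rfl⟩ : ∃ κ, δ = 4 * κ := ⟨δ / 4, by ring⟩
  have hκ : 0 < κ := by linarith
  set ρ : ℝ := √d / √κ with hρ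
  have hρ0 : 0 ≤ ρ := by positivity
  set K : ℝ := ρ / κ + 2 * ρ / κ ^ 2 + 2 * ρ ^ 2 / κ with hK
  have hKρ : 2 * ρ ^ 2 / κ ≤ K := by
    have : 0 ≤ ρ / κ + 2 * ρ / κ ^ 2 := by positivity
    linarith
  have hγ : 0 < (4 * κ / (2 * d + 1)) ^ 2 / 2 := by positivity
  -- In order: absorption of K; tails of the edge sums; smallness of E² (5 because 1 + 4 log²n ≤ 5
  -- log²n); nearness of M to an orthogonal matrix; tails of the Gram entries; polynomial
  -- prefactors.
  have hev := (eventually_le_log (2 * K)).and <| (eventually_le_log (2 * (c + 3))).and <|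
    (eventually_mul_log_pow_le 5 (by positivity : 0 < κ ^ 4 / 16) 2).and <|
    (eventually_mul_log_pow_le d (by norm_num : (0 : ℝ) < 1 / 2) 4).and <|
    (eventually_mul_log_pow_le (c + 3) hγ 1).and <|
    Filter.eventually_ge_atTop (2 * d + 2 + 2 * d ^ 2 + 4)
  obtain ⟨n₀, hn₀⟩ := Filter.eventually_atTop.1 hev
  refine ⟨n₀, fun n hn η hη _ => ?_⟩
  obtain ⟨hlogK, hlogc, hlog2, hlog4, hlog1, hbig⟩ := hn₀ n hn.le
  have hn0 : 0 < n := by omega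
  have hN : (0 : ℝ) < n := by exact_mod_cast hn0
  have hlog : 1 ≤ Real.log n := by linarith
  have hsqrt : 2 ≤ √(n : ℝ) := by
    refine Real.le_sqrt_of_sq_le ?_
    have : (4 : ℕ) ≤ n := by omega
    have : (4 : ℝ) ≤ n := by exact_mod_cast this
    linarith
  have hsq : √(n : ℝ) * √n = n := Real.mul_self_sqrt hN.le
  set t : ℝ := √n * Real.log n with ht
  set u : ℝ := n * (4 * κ) / (2 * d + 1) with hu
  have ht2 : t + 2 ≤ 2 * (√n * Real.log n) := by nlinarith
  have ht0 : 0 ≤ t := by positivity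
  have hsize : n + (t + 2) ^ 2 ≤ κ ^ 4 * n ^ 2 / 16 := by
    calc n + (t + 2) ^ 2 ≤ n + (2 * (√n * Real.log n)) ^ 2 := by gcongr
      _ = n * (1 + 4 * Real.log n ^ 2) := by
        rw [mul_pow, mul_pow, Real.sq_sqrt hN.le]; ring
      _ ≤ n * (κ ^ 4 / 16 * n) := by
        gcongr
        nlinarith
      _ = _ := by ring
  have hfinal : √d * (t + 2) / n * K ≤ 1 * √(d : ℝ) * Real.log n ^ 2 / √(n : ℝ) := by
    have hK0 : 0 ≤ K := by positivity
    calc √d * (t + 2) / n * K ≤ √d * (2 * (√n * Real.log n)) / n * K := by gcongr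
      _ = √d * (√n * Real.log n) / n * (2 * K) := by ring
      _ ≤ √d * (√n * Real.log n) / n * Real.log n := by gcongr
      _ = √d * (√n * Real.log n) / (√n * √n) * Real.log n := by rw [hsq]
      _ = _ := by field_simp
  have hsmall : √d * (t + 2) / n * (2 * ρ ^ 2 / κ) < 1 := by
    calc √d * (t + 2) / n * (2 * ρ ^ 2 / κ) ≤ √d * (t + 2) / n * K := by gcongr
      _ ≤ 1 * √(d : ℝ) * Real.log n ^ 2 / √(n : ℝ) := hfinal
      _ < 1 := by
        rw [div_lt_one (by positivity), one_mul]
        refine Real.lt_sqrt_of_sq_lt ?_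
        rw [mul_pow, Real.sq_sqrt (by positivity)]
        have : (Real.log n ^ 2) ^ 2 = Real.log n ^ 4 := by ring
        rw [this]
        linarith
  have hdev := (hRDPG n).measureReal_deviation_le hF ht0 (by positivity : 0 ≤ u)
  have htail := tail_sum_le_rpow_neg (d := d) (u := u) hn0 ht hlogc (by linarith) (by
    rw [pow_one] at hlog1
    refine hlog1.trans (le_of_eq ?_)
    rw [hu]
    field_simp) (by omega)
  set D := {ω | ¬((∀ i j, ⟪X n i ω, X n j ω⟫ ∈ Set.Icc (0 : ℝ) 1) ∧
      (∀ i k, |∑ j ∈ Finset.univ.erase i, (A n ω i j - ⟪X n i ω, X n j ω⟫) * X n j ω k| ≤ t) ∧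
      (∀ i k, i ≠ k → |∑ j ∈ (Finset.univ.erase i).erase k,
        (A n ω i j - ⟪X n i ω, X n j ω⟫) * (A n ω k j - ⟪X n k ω, X n j ω⟫)| ≤ t) ∧
      ∀ k l, |∑ i, (X n i ω k * X n i ω l - secondMoment F k l)| ≤ u)} with hD
  set G := {ω | ∀ Xhat : Matrix (Fin n) (Fin d) ℝ, IsASE d (A n ω) Xhat →
    ∃ W ∈ Matrix.orthogonalGroup (Fin d) ℝ,
      twoToInftyNorm (Xhat - positionMatrix (X n) ω * W) ≤
        1 * √(d : ℝ) * Real.log n ^ 2 / √(n : ℝ)} with hG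
  -- Covering the space and using subadditivity avoids any measurability claim about the event G.
  have hcover : Set.univ ⊆ G ∪ D := by
    intro ω _
    by_cases hω : ω ∈ D
    · exact Or.inr hω
    · refine Or.inl fun Xhat hXhat => ?_
      obtain ⟨hin, hrow, hcodeg, hgram⟩ := not_not.1 hω
      obtain ⟨W, hW, hle⟩ := IsASE.twoToInftyNorm_le_of_concentration hn0 hin
        ((hRDPG n).isAdjMatrix ω) hκ ht0 hH hrow hcodeg hgram hsize hρ hsmall hXhat
      exact ⟨W, hW, hle.trans hfinal⟩
  have hone : 1 ≤ (μ n).real G + (μ n).real D := by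
    calc (1 : ℝ) = (μ n).real Set.univ := by simp
      _ ≤ (μ n).real (G ∪ D) := measureReal_mono hcover
      _ ≤ _ := measureReal_union_le _ _
  linarith
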